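/- On $\mathbb{R}\times S^2$, with coordinate $\rho$ on $\mathbb{R}$ and spherical coordinates $\theta\in[0,\pi]$, $\phi\in\mathbb{R}/2\pi\mathbb{Z}$ on $S^2$, let $$\lambda_1=3\cos\theta\,d\rho-\rho\sin\theta\,d\theta+\tfrac12\sin^2\theta\,d\phi ,$$ a smooth contact form. Let $f:\mathbb{R}\to(0,\infty)$ be a smooth function with $\rho f'(\rho)>0$ for all $\rho\neq0$ and $f''(0)>0$, and put $\lambda_f=f(\rho)\lambda_1$, $\xi_1=\ker\lambda_f$. Let $X_f$ be the Reeb vector field of $\lambda_f$; it has a global flow $\psi_t$. A $T$-periodic Reeb orbit ($T>0$) is a map $\gamma:\mathbb{R}/\mathbb{Z}\to\mathbb{R}\times S^2$ with $\dot\gamma=T\,X_f(\gamma)$; it is simple if it is injective. Then: 1. The equator $\gamma_0(t)=(\rho,\theta,\phi)=(0,\pi/2,2\pi t)$ is a simple periodic Reeb orbit, of period $T_0=\pi f(0)$. It is the only simple periodic Reeb orbit, up to the reparametrizations $t\mapsto t+s$. 2. With $g(\theta)=2\cos^2\theta+1$, the vector fields $$v_1=(fg)^{-1}\bigl(-3\cot\theta\,\partial_\phi+\tfrac12\sin\theta\,\partial_\rho\bigr),\qquad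 v_2=2\rho\csc\theta\,\partial_\phi+\partial_\theta$$ restrict along $\gamma_0$ to $\tfrac1{2f(0)}\partial_\rho$ and $\partial_\theta$, and form there a symplectic trivialization of $(\xi_1,d\lambda_f)$, that is, a smooth frame of $\xi_1$ along $\gamma_0$ with $d\lambda_f(v_1,v_2)=1$. 3. The orbit $\gamma_0$ is nondegenerate, hyperbolic and even: the linearized return map $d\psi_{T_0}(\gamma_0(0))$ on $\xi_1$ does not have the eigenvalue $1$, and its eigenvalues are real and positive. 4. The Conley–Zehnder index of $\gamma_0$ relative to the trivialization $\{v_1,v_2\}$ is $0$. That is, $\mu_{cz}(\Psi)=0$ for the path $\Psi=(\Psi_{ij}):[0,1]\to Sp(1)$ of matrices defined by $d\psi_{tT_0}(\gamma_0(0))\,v_j(\gamma_0(0))=\sum_i\Psi_{ij}(t)\,v_i(\gamma_0(t))$. Here $Sp(1)$ is the group of real $2\times2$ matrices preserving $dx\wedge dy$, and $\mu_{cz}$ is the Conley–Zehnder index on the set $\Sigma(1)$ of continuous paths $[0,1]\to Sp(1)$ from the identity to a matrix without eigenvalue $1$. It is characterized by homotopy invariance within $\Sigma(1)$, by $\mu_{cz}(h\Psi)=2m(h)+\mu_{cz}(\Psi)$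 for loops $h$ in $Sp(1)$ based at the identity with Maslov index $m(h)$ (normalized to be $1$ on the loop of rotations by $2\pi t$), and by $\mu_{cz}(\Psi^{-1})=-\mu_{cz}(\Psi)$. Geometrically: let $I(\Psi)\subset\mathbb{R}$ be the set of the total numbers of turns around $0$ of the curves $t\mapsto\Psi(t)z$, $t\in[0,1]$, for $z\neq0$; then $\mu_{cz}(\Psi)=2k$ if the integer $k$ lies in $I(\Psi)$, and $\mu_{cz}(\Psi)=2k+1$ if $I(\Psi)\subset(k,k+1)$. The index of $\Psi$ is $0$ in both senses. -/

import Mathlib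

open scoped ContDiff

noncomputable section

/-! ### The manifold `ℝ × S²`, differential forms on it, Reeb dynamics -/

/-- The ambient space of `ℝ × S²`; a point is written `(ρ, x)`. -/
abbrev Amb : Type := ℝ × EuclideanSpace ℝ (Fin 3)

/-- The manifold `ℝ × S²`, with `S²` the unit sphere of `ℝ³`. -/
def neck : Set Amb := Set.univ ×ˢ Metric.sphere (0 : EuclideanSpace ℝ (Fin 3)) 1

/-- The tangent space of `ℝ × S²` at `p = (ρ, x)`: all `(a, w)` with `w` orthogonal to `x`. -/
def tangentNeck (p : Amb) : Submodule ℝ Amb :=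
  LinearMap.ker
    ((innerSL ℝ p.2).comp (ContinuousLinearMap.snd ℝ ℝ (EuclideanSpace ℝ (Fin 3)))).toLinearMap

/-- The exterior derivative of a 1-form: `formD α p u w = dα_p (u, w)`. A 1-form on `ℝ × S²` is given
here by an extension to the ambient space; on vectors tangent to `ℝ × S²` the exterior derivative of
the extension is that of the form on `ℝ × S²`. -/
def formD (α : Amb → Amb →L[ℝ] ℝ) (p u w : Amb) : ℝ :=
  extDeriv (fun q => ContinuousAlternatingMap.ofSubsingleton ℝ Amb ℝ (0 : Fin 1) (α q)) p ![u, w]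

/-- The contact plane `ξ_p = ker α_p` in the tangent space of `ℝ × S²`. -/
def contactPlane (α : Amb → Amb →L[ℝ] ℝ) (p : Amb) : Submodule ℝ Amb :=
  tangentNeck p ⊓ LinearMap.ker (α p).toLinearMap

/-- `X` is the value at `p` of the Reeb vector field of `α`: a tangent vector with
`α(X) = 1` and `i_X dα = 0` on the tangent space. -/
structure IsReebVector (α : Amb → Amb →L[ℝ] ℝ) (p X : Amb) : Prop where
  tangent : X ∈ tangentNeck p
  form_eq_one : α p X = 1
  contract_eq_zero : ∀ w ∈ tangentNeck p, formD α p X w = 0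

/-- `ψ` is the (global) flow of the Reeb vector field of `α` on `ℝ × S²`. The values of `ψ t` off
`ℝ × S²` are irrelevant. -/
structure IsReebFlow (α : Amb → Amb →L[ℝ] ℝ) (ψ : ℝ → Amb → Amb) : Prop where
  zero : ∀ p ∈ neck, ψ 0 p = p
  mem : ∀ p ∈ neck, ∀ t, ψ t p ∈ neck
  deriv : ∀ p ∈ neck, ∀ t, ∃ X, IsReebVector α (ψ t p) X ∧ HasDerivAt (fun s => ψ s p) X t

/-- `γ : ℝ / ℤ → ℝ × S²` (a 1-periodic map on `ℝ`) is a `T`-periodic Reeb orbit: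
`T > 0` and `γ' = T • X(γ)`. -/
structure IsPeriodicReebOrbit (α : Amb → Amb →L[ℝ] ℝ) (T : ℝ) (γ : ℝ → Amb) : Prop where
  period_pos : 0 < T
  periodic : Function.Periodic γ 1
  mem : ∀ t, γ t ∈ neck
  deriv : ∀ t, ∃ X, IsReebVector α (γ t) X ∧ HasDerivAt γ (T • X) t

/-- A periodic Reeb orbit is simple if it is injective on `ℝ / ℤ`. -/
structure IsSimpleReebOrbit (α : Amb → Amb →L[ℝ] ℝ) (T : ℝ) (γ : ℝ → Amb) : Prop
    extends IsPeriodicReebOrbit α T γ where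
  simple : ∀ s t, γ s = γ t → ∃ n : ℤ, t = s + n

/-! ### Linearized flow along a periodic orbit -/

/-- `A` is the linearized return map `dψ_T(γ(0))` on the contact plane at `γ(0)`. The derivative is
taken along `ℝ × S²`, so that `D` is determined on the tangent space. -/
def IsReturnMap (α : Amb → Amb →L[ℝ] ℝ) (ψ : ℝ → Amb → Amb) (T : ℝ) (γ : ℝ → Amb)
    (A : Module.End ℝ (contactPlane α (γ 0))) : Prop :=
  ∃ D : Amb →L[ℝ] Amb, HasFDerivWithinAt (ψ T) D neck (γ 0) ∧
    ∀ v : contactPlane α (γ 0), ((A v : contactPlane α (γ 0)) : Amb) = D v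

/-- The orbit is nondegenerate (`1` is not in the spectrum of the return map) and hyperbolic (all
complex eigenvalues of the return map are real, that is, its characteristic polynomial splits
over `ℝ`). -/
def IsHyperbolicOrbit (α : Amb → Amb →L[ℝ] ℝ) (ψ : ℝ → Amb → Amb) (T : ℝ) (γ : ℝ → Amb) : Prop :=
  ∃ A, IsReturnMap α ψ T γ A ∧ (1 : ℝ) ∉ spectrum ℝ A ∧ A.charpoly.Splits

/-- The orbit is even: hyperbolic (in particular nondegenerate), with positive eigenvalues. -/
def IsEvenOrbit (α : Amb → Amb →L[ℝ] ℝ) (ψ : ℝ → Amb → Amb) (T : ℝ) (γ : ℝ → Amb) : Prop :=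
  ∃ A, IsReturnMap α ψ T γ A ∧ (1 : ℝ) ∉ spectrum ℝ A ∧ A.charpoly.Splits ∧
    ∀ μ ∈ spectrum ℝ A, 0 < μ

/-- `v 0, v 1` is a symplectic trivialization of `(ξ, dα)` along `γ`: a smooth 1-periodic frame of
`γ^* ξ` with `dα (v 0, v 1) = 1`. -/
structure IsSymplecticFrame (α : Amb → Amb →L[ℝ] ℝ) (γ : ℝ → Amb) (v : Fin 2 → ℝ → Amb) :
    Prop where
  smooth : ∀ i, ContDiff ℝ ∞ (v i)
  periodic : ∀ i, Function.Periodic (v i) 1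
  mem : ∀ i t, v i t ∈ contactPlane α (γ t)
  symplectic : ∀ t, formD α (γ t) (v 0 t) (v 1 t) = 1

/-! ### Paths of symplectic matrices and the Conley–Zehnder index -/

/-- The group `Sp(1)` of real `2 × 2` matrices preserving `dx ∧ dy`. -/
def Sp1 : Set (Matrix (Fin 2) (Fin 2) ℝ) :=
  {A | A.transpose * !![0, 1; -1, 0] * A = !![0, 1; -1, 0]}

/-- The space `Σ(1)` of continuous paths in `Sp(1)` from the identity to a matrix without
eigenvalue `1`. -/
structure CZPath where
  path : C(unitInterval, Matrix (Fin 2) (Fin 2) ℝ)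
  mem : ∀ t, path t ∈ Sp1
  source : path 0 = 1
  target : (path 1 - 1).det ≠ 0

/-- `Ψ` is the path `t ↦ Φ(t)⁻¹ dψ_{tT}(γ(0)) Φ(0)` of matrices of the linearized flow of `ψ` along
`γ` in the frame `v`, that is `dψ_{tT}(γ(0)) v_j(0) = ∑ i, Ψ_{ij}(t) v_i(t)`. -/
def IsLinearizedFlowPath (ψ : ℝ → Amb → Amb) (T : ℝ) (γ : ℝ → Amb)
    (v : Fin 2 → ℝ → Amb) (Ψ : CZPath) : Prop :=
  ∀ t : unitInterval, ∃ D : Amb →L[ℝ] Amb,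
    HasFDerivWithinAt (ψ ((t : ℝ) * T)) D neck (γ 0) ∧
    ∀ j, D (v j 0) = ∑ i, Ψ.path t i j • v i t

/-- The set of all numbers of turns `(θ(1) - θ(0)) / 2π` that the vectors `Ψ(t) z` make around the
origin, where `z` is a nonzero vector and `θ` a continuous angle function of `t ↦ Ψ(t) z`. -/
def windingInterval (Ψ : CZPath) : Set ℝ :=
  {a | ∃ z : Fin 2 → ℝ, z ≠ 0 ∧ ∃ (θ : C(unitInterval, ℝ)) (r : unitInterval → ℝ),
    (∀ t, 0 < r t ∧
      (Ψ.path t).mulVec z = ![r t * Real.cos (θ t), r t * Real.sin (θ t)]) ∧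
    a = (θ 1 - θ 0) / (2 * Real.pi)}

/-- The Conley–Zehnder index of `Ψ` is `n` (geometric definition). The winding interval is a compact
interval of length less than `1/2`; it either contains an integer `k`, and the index is `2 k`, or it
lies strictly between two consecutive integers `k` and `k + 1`, and the index is `2 k + 1`. -/
def HasCZIndex (Ψ : CZPath) (n : ℤ) : Prop :=
  ∃ k : ℤ, (n = 2 * k ∧ (k : ℝ) ∈ windingInterval Ψ) ∨
    (n = 2 * k + 1 ∧ windingInterval Ψ ⊆ Set.Ioo (k : ℝ) (k + 1))

/-- Homotopy of paths within `Σ(1)`; the end point may move. -/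
def CZPath.Homotopic (Ψ₀ Ψ₁ : CZPath) : Prop :=
  ∃ H : C(unitInterval × unitInterval, Matrix (Fin 2) (Fin 2) ℝ),
    (∀ s t, H (s, t) ∈ Sp1) ∧ (∀ s, H (s, 0) = 1) ∧ (∀ s, (H (s, 1) - 1).det ≠ 0) ∧
    (∀ t, H (0, t) = Ψ₀.path t) ∧ (∀ t, H (1, t) = Ψ₁.path t)

/-- The loop `g` in `Sp(1)` based at the identity has Maslov index `k`: it is homotopic, through loops
in `Sp(1)` based at the identity, to the `k`-th power of the loop of rotations by `2πt`. -/
def HasMaslovIndex (g : C(unitInterval, Matrix (Fin 2) (Fin 2) ℝ)) (k : ℤ) : Prop :=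
  ∃ H : C(unitInterval × unitInterval, Matrix (Fin 2) (Fin 2) ℝ),
    (∀ s t, H (s, t) ∈ Sp1) ∧ (∀ s, H (s, 0) = 1) ∧ (∀ s, H (s, 1) = 1) ∧
    (∀ t, H (0, t) = g t) ∧
    (∀ t : unitInterval, H (1, t) =
      !![Real.cos (2 * Real.pi * k * t), -Real.sin (2 * Real.pi * k * t);
         Real.sin (2 * Real.pi * k * t), Real.cos (2 * Real.pi * k * t)])

/-- The axioms that characterize the Conley–Zehnder index as a map `Σ(1) → ℤ`. -/
structure IsCZIndexMap (μ : CZPath → ℤ) : Prop where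
  homotopy : ∀ Ψ₀ Ψ₁, CZPath.Homotopic Ψ₀ Ψ₁ → μ Ψ₀ = μ Ψ₁
  maslov : ∀ g k, HasMaslovIndex g k →
    ∀ Ψ Ψ' : CZPath, (∀ t, Ψ'.path t = g t * Ψ.path t) → μ Ψ' = 2 * k + μ Ψ
  inverse : ∀ Ψ Ψ' : CZPath, (∀ t, Ψ'.path t = (Ψ.path t)⁻¹) → μ Ψ' = -μ Ψ

/-! ### The contact form `f λ₁` in spherical coordinates -/

/-- Spherical coordinates `(ρ, θ, φ)` on `ℝ × S²`. -/
def sph (ρ θ φ : ℝ) : Amb :=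
  (ρ, !₂[Real.sin θ * Real.cos φ, Real.sin θ * Real.sin φ, Real.cos θ])

/-- The coordinate vector field `∂_ρ`. -/
def dRho (ρ θ φ : ℝ) : Amb := deriv (fun s => sph s θ φ) ρ

/-- The coordinate vector field `∂_θ`. -/
def dTheta (ρ θ φ : ℝ) : Amb := deriv (fun s => sph ρ s φ) θ

/-- The coordinate vector field `∂_φ`. -/
def dPhi (ρ θ φ : ℝ) : Amb := deriv (fun s => sph ρ θ s) φ

/-- The `i`-th Cartesian coordinate `x_i` of the sphere factor, as a linear functional. -/
def coordX (i : Fin 3) : Amb →L[ℝ] ℝ :=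
  (EuclideanSpace.proj (𝕜 := ℝ) i).comp
    (ContinuousLinearMap.snd ℝ ℝ (EuclideanSpace ℝ (Fin 3)))

/-- `λ₁ = 3 cos θ dρ - ρ sin θ dθ + (1/2) sin² θ dφ`, written in the Cartesian coordinates of
`S² ⊆ ℝ³` as `3 x₂ dρ + ρ dx₂ + (1/2) (x₀ dx₁ - x₁ dx₀)`; see `lambdaOne_sph`. -/
def lambdaOne (p : Amb) : Amb →L[ℝ] ℝ :=
  (3 * p.2 2) • ContinuousLinearMap.fst ℝ ℝ (EuclideanSpace ℝ (Fin 3)) + p.1 • coordX 2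
    + (1 / 2 : ℝ) • (p.2 0 • coordX 1 - p.2 1 • coordX 0)

/-- The form `f λ₁`, for a function `f` of `ρ`. -/
def lambdaF (f : ℝ → ℝ) (p : Amb) : Amb →L[ℝ] ℝ := f p.1 • lambdaOne p

/-- The vector field
`v₁ = (f g)⁻¹ (-3 cot θ ∂_φ + (1/2) sin θ ∂_ρ)`, where `g = 2 cos² θ + 1`. -/
def frameOne (f : ℝ → ℝ) (ρ θ φ : ℝ) : Amb :=
  (f ρ * (2 * Real.cos θ ^ 2 + 1))⁻¹ •
    ((-3 * Real.cot θ) • dPhi ρ θ φ + (1 / 2 * Real.sin θ) • dRho ρ θ φ)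

/-- The vector field `v₂ = 2 ρ csc θ ∂_φ + ∂_θ`. -/
def frameTwo (ρ θ φ : ℝ) : Amb :=
  (2 * ρ * (Real.sin θ)⁻¹) • dPhi ρ θ φ + dTheta ρ θ φ

/-- The equator `t ↦ (ρ, θ, φ) = (0, π/2, 2πt)`. -/
def equator (t : ℝ) : Amb := sph 0 (Real.pi / 2) (2 * Real.pi * t)

/-- The frame `v₁, v₂` along the equator. -/
def equatorFrame (f : ℝ → ℝ) : Fin 2 → ℝ → Amb :=
  ![fun t => frameOne f 0 (Real.pi / 2) (2 * Real.pi * t),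
    fun t => frameTwo 0 (Real.pi / 2) (2 * Real.pi * t)]

theorem hasDerivAt_vec3 {a b c : ℝ → ℝ} {a' b' c' t : ℝ} (ha : HasDerivAt a a' t)
    (hb : HasDerivAt b b' t) (hc : HasDerivAt c c' t) :
    HasDerivAt (fun s => (!₂[a s, b s, c s] : EuclideanSpace ℝ (Fin 3))) !₂[a', b', c'] t := by
  have h : HasDerivAt (fun s => ![a s, b s, c s]) ![a', b', c'] t := by
    refine hasDerivAt_pi.2 fun i => ?_
    fin_cases i <;> simpa
  exact (PiLp.continuousLinearEquiv 2 ℝ (fun _ : Fin 3 => ℝ)).symm.hasFDerivAt.comp_hasDerivAt t h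

theorem dRho_eq (ρ θ φ : ℝ) : dRho ρ θ φ = (1, 0) :=
  ((hasDerivAt_id ρ).prodMk (hasDerivAt_const ρ _)).deriv

theorem dTheta_eq (ρ θ φ : ℝ) : dTheta ρ θ φ =
    (0, !₂[Real.cos θ * Real.cos φ, Real.cos θ * Real.sin φ, -Real.sin θ]) :=
  ((hasDerivAt_const θ ρ).prodMk (hasDerivAt_vec3 ((Real.hasDerivAt_sin θ).mul_const _)
    ((Real.hasDerivAt_sin θ).mul_const _) (Real.hasDerivAt_cos θ))).deriv

theorem dPhi_eq (ρ θ φ : ℝ) : dPhi ρ θ φ =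
    (0, !₂[Real.sin θ * -Real.sin φ, Real.sin θ * Real.cos φ, 0]) :=
  ((hasDerivAt_const φ ρ).prodMk (hasDerivAt_vec3 ((Real.hasDerivAt_cos φ).const_mul _)
    ((Real.hasDerivAt_sin φ).const_mul _) (hasDerivAt_const φ _))).deriv

/-- The formula for `λ₁` in spherical coordinates. -/
theorem lambdaOne_sph (ρ θ φ a b c : ℝ) :
    lambdaOne (sph ρ θ φ) (a • dRho ρ θ φ + b • dTheta ρ θ φ + c • dPhi ρ θ φ)
      = 3 * Real.cos θ * a - ρ * Real.sin θ * b + 1 / 2 * Real.sin θ ^ 2 * c := by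
  rw [dRho_eq, dTheta_eq, dPhi_eq]
  simp [lambdaOne, sph, coordX]
  linear_combination (1 / 2 * Real.sin θ ^ 2 * c) * Real.sin_sq_add_cos_sq φ

end

/-!
On the cylinder `ℝ × {x ∈ ℝ³ : |x| = 1}` the Reeb field of `f λ₁` is
`(f² g)⁻¹ (f x₂ ∂_ρ + (1/2) f' (1 - x₂²) ∂_{x₂} + …)`, with `g = 2 x₂² + 1` (`reebField`,
`IsReebVector.components`). Hence `ρ x₂` is nondecreasing along every trajectory, and its derivative
vanishes only where `ρ = x₂ = 0` (`IsReebVector.rho_mul_height`). Along a periodic orbit `ρ x₂` is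
periodic and monotone, thus constant, so the orbit lies on the equator, where the Reeb field is the
rotation field of speed `2 / f 0` (`IsSimpleReebOrbit.eq_equator`).

The Cartesian form of the Reeb field is smooth on `ℝ × ℝ³`, preserves `|x|`, and has `ρ`-component at
most `1 / f 0`; these bounds make its flow complete (`exists_global_solution`). The linearization of
the field is the same at all points of the equator (`fderiv_reebField_equatorial`), so the linearized
equation is solved by explicit functions (`linFlow`), and a Grönwall estimate shows that the solution
is the derivative of the flow (`hasFDerivWithinAt_flow`). In the frame `v₁, v₂` it is
`exp (t B)` with `B = [[0, -2/κ], [-κ/2, 0]]`, up to scaling of `t`, where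
`κ² = f'' 0 / (2 (f 0)³) > 0`. As `B` has the eigenvalues `±1`, the return map is hyperbolic
with positive eigenvalues.

For the Conley–Zehnder index: an eigenvector of `B` does not turn, and no vector makes a nonzero whole
number of turns because `exp (t B)` has no negative eigenvalue, so the geometric index is `0`. For an
index given by the axioms, `B` is joined to `-B` through matrices with eigenvalues `±1`, so that the
path is homotopic in `Σ(1)` to its inverse and its index equals its negative
(`IsCZIndexMap.hypPath_eq_zero`).
-/

open Set Metric Filter Topology

/-! ### Global integral curves and differentiability of flows -/

section ODE

variable {E : Type*} [NormedAddCommGroup E] [NormedSpace ℝ E] [FiniteDimensional ℝ E]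

/-- A `C¹` vector field has a global integral curve through `p` as soon as the integral curves of
all its truncations `χ V`, `0 ≤ χ ≤ 1`, obey an a priori bound on every bounded time interval:
for a bump function `χ` the field `χ V` is bounded and Lipschitz, so the Picard–Lindelöf theorem
applies on the whole interval, and by the bound the solution does not leave `{χ = 1}`. -/
theorem exists_global_solution {V : E → E} (hV : ContDiff ℝ 1 V) (p : E) (R : ℝ → ℝ)
    (hR : ∀ N > 0, ∀ χ : E → ℝ, (∀ x, χ x ∈ Icc (0 : ℝ) 1) → ∀ α : ℝ → E, α 0 = p →
      (∀ t ∈ Ioo (-N) N, HasDerivAt α (χ (α t) • V (α t)) t) →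
      ∀ t ∈ Ioo (-N) N, ‖α t‖ ≤ R N) :
    ∃ γ : ℝ → E, γ 0 = p ∧ ∀ t, HasDerivAt γ (V (γ t)) t := by
  have key : ∀ N > 0, ∃ α : ℝ → E, α 0 = p ∧ (∀ t ∈ Ioo (-N) N, HasDerivAt α (V (α t)) t) ∧
      ∀ t ∈ Ioo (-N) N, ‖α t‖ ≤ R N := by
    intro N hN
    let χ : ContDiffBump (0 : E) := ⟨|R N| + 1, |R N| + 2, by positivity, by linarith⟩
    have hWc : ContDiff ℝ 1 (fun x => χ x • V x) := χ.contDiff.smul hV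
    have hWs : HasCompactSupport (fun x => χ x • V x) := χ.hasCompactSupport.smul_right
    obtain ⟨K, hK⟩ := ContDiff.lipschitzWith_of_hasCompactSupport hWs hWc one_ne_zero
    obtain ⟨L, hL⟩ := hWs.exists_bound_of_continuous hWc.continuous
    let t₀ : Icc (-N) N := ⟨0, by simp [hN.le]⟩
    have hpl : IsPicardLindelof (fun _ x => χ x • V x) t₀ p
        (Real.toNNReal L * Real.toNNReal N) 0 (Real.toNNReal L) K :=
      { lipschitzOnWith := fun _ _ => hK.lipschitzOnWith
        continuousOn := fun _ _ => continuousOn_const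
        norm_le := fun _ _ x _ => (hL x).trans (Real.le_coe_toNNReal L)
        mul_max_le := by simp [t₀, hN.le] }
    obtain ⟨α, hα0, hα⟩ := hpl.exists_eq_forall_mem_Icc_hasDerivWithinAt₀
    have hd : ∀ t ∈ Ioo (-N) N, HasDerivAt α (χ (α t) • V (α t)) t := fun t ht =>
      (hα t (Ioo_subset_Icc_self ht)).hasDerivAt (Icc_mem_nhds ht.1 ht.2)
    have hb := hR N hN χ (fun x => ⟨χ.nonneg, χ.le_one⟩) α hα0 hd
    refine ⟨α, hα0, fun t ht => ?_, hb⟩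
    have h1 : χ (α t) = 1 := χ.one_of_mem_closedBall (by
      rw [mem_closedBall_zero_iff]
      show ‖α t‖ ≤ |R N| + 1
      linarith [hb t ht, le_abs_self (R N)])
    simpa [h1] using hd t ht
  choose! α hα0 hα hαb using key
  have huniq : ∀ a > 0, ∀ b > 0, ∀ t, |t| < a → |t| < b → α a t = α b t := by
    intro a ha b hb t hta htb
    obtain ⟨K, hK⟩ := hV.contDiffOn.exists_lipschitzOnWith one_ne_zero
      (convex_closedBall (0 : E) (max (R a) (R b))) (isCompact_closedBall _ _)
    have hm : 0 < min a b := lt_min ha hb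
    have hsub : ∀ t ∈ Ioo (-min a b) (min a b), t ∈ Ioo (-a) a ∧ t ∈ Ioo (-b) b := by
      intro t ht
      have h := lt_min_iff.1 (abs_lt.2 (mem_Ioo.1 ht))
      exact ⟨abs_lt.1 h.1, abs_lt.1 h.2⟩
    exact ODE_solution_unique_of_mem_Ioo (v := fun _ => V)
      (s := fun _ => closedBall (0 : E) (max (R a) (R b))) (t₀ := 0) (fun _ _ => hK)
      (by simp [hm])
      (fun t ht => ⟨hα a ha t (hsub t ht).1,
        mem_closedBall_zero_iff.2 ((hαb a ha t (hsub t ht).1).trans (le_max_left _ _))⟩)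
      (fun t ht => ⟨hα b hb t (hsub t ht).2,
        mem_closedBall_zero_iff.2 ((hαb b hb t (hsub t ht).2).trans (le_max_right _ _))⟩)
      ((hα0 a ha).trans (hα0 b hb).symm) (abs_lt.1 (lt_min hta htb))
  refine ⟨fun t => α (|t| + 1) t, hα0 _ (by positivity), fun t => ?_⟩
  refine (hα (|t| + 1) (by positivity) t (abs_lt.1 (lt_add_one _))).congr_of_eventuallyEq ?_
  filter_upwards [continuous_abs.continuousAt.eventually (gt_mem_nhds (lt_add_one |t|))] with s hs
  exact huniq _ (by positivity) _ (by positivity) s (lt_add_one _) hs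

/-- The flow of a `C²` vector field is differentiable in the initial point, and its derivative
solves the linearized equation along the orbit. The derivative is taken along a set `S` of initial
points whose orbits up to time `T` stay in a fixed ball. -/
theorem hasFDerivWithinAt_flow {V : E → E} (hV : ContDiff ℝ 2 V) {S : Set E} {ψ : ℝ → E → E}
    {p₀ : E} (hp₀ : p₀ ∈ S) {T R : ℝ} (hT : 0 ≤ T)
    (hR : ∀ᶠ p in 𝓝[S] p₀, ∀ t ∈ Icc 0 T, ‖ψ t p‖ ≤ R)
    (hψ0 : ∀ p ∈ S, ψ 0 p = p)
    (hψ : ∀ p ∈ S, ∀ t ∈ Icc 0 T, HasDerivAt (fun s => ψ s p) (V (ψ t p)) t)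
    (D : ℝ → E →L[ℝ] E) (hD0 : D 0 = ContinuousLinearMap.id ℝ E)
    (hD : ∀ h, ∀ t ∈ Icc 0 T, HasDerivAt (fun s => D s h) (fderiv ℝ V (ψ t p₀) (D t h)) t) :
    HasFDerivWithinAt (ψ T) (D T) S p₀ := by
  have hcv := convex_closedBall (0 : E) R
  have hcp := isCompact_closedBall (0 : E) R
  have hdiff : Differentiable ℝ V := hV.differentiable two_ne_zero
  have hV' : ContDiff ℝ 1 (fderiv ℝ V) := hV.fderiv_right (by norm_num)
  obtain ⟨K, hK⟩ := hV.contDiffOn.exists_lipschitzOnWith two_ne_zero hcv hcp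
  obtain ⟨M, hM⟩ := hV'.contDiffOn.exists_lipschitzOnWith one_ne_zero hcv hcp
  obtain ⟨C, hC⟩ := hcp.exists_bound_of_continuousOn (hV'.continuous.continuousOn)
  have hC1 : 0 < max C 1 := lt_max_of_lt_right one_pos
  have hR₀ := hR.self_of_nhdsWithin hp₀
  set e := Real.exp (K * T) with he
  -- Grönwall's bound, with `max C 1` in place of `C` to have a positive rate
  have hbound : ∀ᶠ p in 𝓝[S] p₀, ‖ψ T p - ψ T p₀ - D T (p - p₀)‖ ≤
      (M * e ^ 2 / max C 1 * (Real.exp (max C 1 * T) - 1)) * ‖p - p₀‖ ^ 2 := by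
    filter_upwards [hR, self_mem_nhdsWithin] with p hRp hp
    have hd : ∀ t ∈ Icc 0 T, dist (ψ t p) (ψ t p₀) ≤ ‖p - p₀‖ * e := by
      intro t ht
      have := dist_le_of_trajectories_ODE_of_mem (v := fun _ => V) (K := K)
        (s := fun _ => closedBall (0 : E) R) (f := fun t => ψ t p) (g := fun t => ψ t p₀)
        (a := 0) (b := T) (δ := ‖p - p₀‖) (fun _ _ => hK)
        (fun t ht => (hψ p hp t ht).continuousAt.continuousWithinAt)
        (fun t ht => (hψ p hp t (Ico_subset_Icc_self ht)).hasDerivWithinAt)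
        (fun t ht => mem_closedBall_zero_iff.2 (hRp t (Ico_subset_Icc_self ht)))
        (fun t ht => (hψ p₀ hp₀ t ht).continuousAt.continuousWithinAt)
        (fun t ht => (hψ p₀ hp₀ t (Ico_subset_Icc_self ht)).hasDerivWithinAt)
        (fun t ht => mem_closedBall_zero_iff.2 (hR₀ t (Ico_subset_Icc_self ht)))
        (by simp [hψ0 p hp, hψ0 p₀ hp₀, dist_eq_norm]) t ht
      refine this.trans ?_
      rw [sub_zero, he]
      gcongr
      exact ht.2
    -- the error of the linear approximation solves the linearized equation up to `O(‖p - p₀‖²)`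
    have hw : ∀ t ∈ Icc 0 T, HasDerivAt (fun s => ψ s p - ψ s p₀ - D s (p - p₀))
        (V (ψ t p) - V (ψ t p₀) - fderiv ℝ V (ψ t p₀) (D t (p - p₀))) t := fun t ht =>
      ((hψ p hp t ht).sub (hψ p₀ hp₀ t ht)).sub (hD _ t ht)
    have hw' : ∀ t ∈ Icc 0 T, ‖V (ψ t p) - V (ψ t p₀) - fderiv ℝ V (ψ t p₀) (D t (p - p₀))‖ ≤
        max C 1 * ‖ψ t p - ψ t p₀ - D t (p - p₀)‖ + M * e ^ 2 * ‖p - p₀‖ ^ 2 := by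
      intro t ht
      set A := fderiv ℝ V (ψ t p₀)
      have hq₀ : ψ t p₀ ∈ closedBall (0 : E) R := mem_closedBall_zero_iff.2 (hR₀ t ht)
      have h1 : ‖V (ψ t p) - V (ψ t p₀) - A (ψ t p - ψ t p₀)‖ ≤
          (M * (‖p - p₀‖ * e)) * ‖ψ t p - ψ t p₀‖ := by
        refine Convex.norm_image_sub_le_of_norm_fderiv_le' (𝕜 := ℝ)
          (s := closedBall 0 R ∩ closedBall (ψ t p₀) (‖p - p₀‖ * e)) (fun x _ => hdiff x) ?_
          (hcv.inter (convex_closedBall _ _)) ⟨hq₀, mem_closedBall_self (by positivity)⟩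
          ⟨mem_closedBall_zero_iff.2 (hRp t ht), hd t ht⟩
        rintro x ⟨hx, hx'⟩
        rw [← dist_eq_norm]
        exact (hM.dist_le_mul x hx _ hq₀).trans (by gcongr; exact hx')
      have h2 : ‖A (ψ t p - ψ t p₀ - D t (p - p₀))‖ ≤
          max C 1 * ‖ψ t p - ψ t p₀ - D t (p - p₀)‖ :=
        A.le_of_opNorm_le ((hC _ hq₀).trans (le_max_left _ _)) _
      have h3 : V (ψ t p) - V (ψ t p₀) - A (D t (p - p₀)) =
          A (ψ t p - ψ t p₀ - D t (p - p₀)) + (V (ψ t p) - V (ψ t p₀) - A (ψ t p - ψ t p₀)) := by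
        rw [map_sub A (ψ t p - ψ t p₀)]; abel
      rw [h3]
      refine (norm_add_le _ _).trans (add_le_add h2 (h1.trans ?_))
      have := hd t ht
      rw [dist_eq_norm] at this
      calc (M * (‖p - p₀‖ * e)) * ‖ψ t p - ψ t p₀‖
          ≤ (M * (‖p - p₀‖ * e)) * (‖p - p₀‖ * e) := by gcongr
        _ = _ := by ring
    have := norm_le_gronwallBound_of_norm_deriv_right_le (a := 0) (b := T) (δ := 0)
      (f := fun s => ψ s p - ψ s p₀ - D s (p - p₀))
      (fun t ht => (hw t ht).continuousAt.continuousWithinAt)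
      (fun t ht => (hw t (Ico_subset_Icc_self ht)).hasDerivWithinAt)
      (by simp [hψ0 p hp, hψ0 p₀ hp₀, hD0])
      (fun t ht => hw' t (Ico_subset_Icc_self ht)) T (right_mem_Icc.2 hT)
    rw [gronwallBound_of_K_ne_0 hC1.ne'] at this
    refine this.trans (le_of_eq ?_)
    simp only [sub_zero]
    ring
  refine .of_isLittleO (Asymptotics.IsBigO.trans_isLittleO (g := fun p => ‖p - p₀‖ ^ 2)
    (.of_bound (M * e ^ 2 / max C 1 * (Real.exp (max C 1 * T) - 1)) (hbound.mono ?_))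
    ((Asymptotics.isLittleO_pow_sub_sub p₀ one_lt_two).mono nhdsWithin_le_nhds))
  intro p hp
  simpa using hp

end ODE

/-! ### The contact form in Cartesian coordinates -/

section Coordinates

theorem mem_neck_iff {p : Amb} : p ∈ neck ↔ p.2 0 ^ 2 + p.2 1 ^ 2 + p.2 2 ^ 2 = 1 := by
  simp [neck, EuclideanSpace.norm_eq, Fin.sum_univ_three]

theorem mem_tangentNeck_iff {p w : Amb} :
    w ∈ tangentNeck p ↔ p.2 0 * w.2 0 + p.2 1 * w.2 1 + p.2 2 * w.2 2 = 0 := by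
  simp [tangentNeck, PiLp.inner_apply, Fin.sum_univ_three, mul_comm]

theorem lambdaOne_apply (p w : Amb) : lambdaOne p w =
    3 * p.2 2 * w.1 + p.1 * w.2 2 + 1 / 2 * (p.2 0 * w.2 1 - p.2 1 * w.2 0) := by
  simp [lambdaOne, coordX]

theorem lambdaF_apply (f : ℝ → ℝ) (p w : Amb) : lambdaF f p w = f p.1 * lambdaOne p w := by
  simp [lambdaF]

theorem amb_ext {p q : Amb} (h : p.1 = q.1) (h0 : p.2 0 = q.2 0) (h1 : p.2 1 = q.2 1)
    (h2 : p.2 2 = q.2 2) : p = q := by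
  refine Prod.ext h ?_
  ext i
  fin_cases i
  exacts [h0, h1, h2]

theorem coordX_apply (i : Fin 3) (p : Amb) : coordX i p = p.2 i := rfl

/-- Derivative of a curve in `ℝ × ℝ³`, coordinate by coordinate. -/
theorem hasDerivAt_amb_iff {γ : ℝ → Amb} {X : Amb} {t : ℝ} :
    HasDerivAt γ X t ↔ HasDerivAt (fun s => (γ s).1) X.1 t ∧
      ∀ i, HasDerivAt (fun s => (γ s).2 i) (X.2 i) t := by
  refine ⟨fun h => ⟨?_, fun i => ?_⟩, fun ⟨h, hi⟩ => ?_⟩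
  · exact (ContinuousLinearMap.fst ℝ ℝ (EuclideanSpace ℝ (Fin 3))).hasFDerivAt.comp_hasDerivAt t h
  · exact (coordX i).hasFDerivAt.comp_hasDerivAt t h
  · exact h.prodMk ((PiLp.continuousLinearEquiv 2 ℝ
      (fun _ : Fin 3 => ℝ)).symm.hasFDerivAt.comp_hasDerivAt t (hasDerivAt_pi.2 hi))

end Coordinates

/-! ### The Reeb vector field -/

section ReebField

variable {f : ℝ → ℝ}

theorem formD_eq {α : Amb → Amb →L[ℝ] ℝ} {p : Amb} (hα : DifferentiableAt ℝ α p) (u w : Amb) :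
    formD α p u w = fderiv ℝ (fun q => α q w) p u - fderiv ℝ (fun q => α q u) p w := by
  have h : DifferentiableAt ℝ
      (fun q => ContinuousAlternatingMap.ofSubsingleton ℝ Amb ℝ (0 : Fin 1) (α q)) p :=
    (ContinuousAlternatingMap.ofSubsingletonLIE (𝕜 := ℝ) (E := Amb) (F := ℝ) (0 : Fin 1)).differentiableAt.comp p hα
  rw [formD, extDeriv_apply h]
  simp [Fin.sum_univ_two, Fin.removeNth, sub_eq_add_neg]

theorem hasFDerivAt_lambdaF_apply {p : Amb} (hf : DifferentiableAt ℝ f p.1) (w : Amb) :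
    HasFDerivAt (fun q => lambdaF f q w)
      ((f p.1) • ((3 * w.1) • coordX 2 + w.2 2 • ContinuousLinearMap.fst ℝ ℝ _ +
        (1 / 2 : ℝ) • (w.2 1 • coordX 0 - w.2 0 • coordX 1)) +
       (lambdaOne p w * deriv f p.1) • ContinuousLinearMap.fst ℝ ℝ (EuclideanSpace ℝ (Fin 3))) p := by
  have h1 : HasFDerivAt (fun q : Amb => f q.1)
      (deriv f p.1 • ContinuousLinearMap.fst ℝ ℝ (EuclideanSpace ℝ (Fin 3))) p :=
    hf.hasDerivAt.comp_hasFDerivAt p (ContinuousLinearMap.fst ℝ ℝ (EuclideanSpace ℝ (Fin 3))).hasFDerivAt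
  have h2 : HasFDerivAt (fun q : Amb => lambdaOne q w)
      ((3 * w.1) • coordX 2 + w.2 2 • ContinuousLinearMap.fst ℝ ℝ _ +
        (1 / 2 : ℝ) • (w.2 1 • coordX 0 - w.2 0 • coordX 1)) p := by
    refine (ContinuousLinearMap.hasFDerivAt _).congr_of_eventuallyEq (.of_forall fun q => ?_)
    simp only [lambdaOne_apply]
    simp [coordX_apply]
    ring
  refine ((h1.mul h2).congr_of_eventuallyEq (.of_forall fun q => lambdaF_apply f q w)).congr_fderiv ?_
  simp [smul_smul]

theorem formD_lambdaF (hf : Differentiable ℝ f) (p u w : Amb) : formD (lambdaF f) p u w =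
    deriv f p.1 * (u.1 * lambdaOne p w - w.1 * lambdaOne p u) +
      f p.1 * (2 * (u.2 2 * w.1 - u.1 * w.2 2) + (u.2 0 * w.2 1 - u.2 1 * w.2 0)) := by
  have hd : DifferentiableAt ℝ (lambdaF f) p := by
    have : Differentiable ℝ lambdaOne := by
      unfold lambdaOne
      fun_prop
    exact ((hf p.1).comp p differentiableAt_fst).smul (this p)
  rw [formD_eq hd, (hasFDerivAt_lambdaF_apply (hf _) w).fderiv,
    (hasFDerivAt_lambdaF_apply (hf _) u).fderiv]
  simp [coordX_apply]
  ring

/-- The Reeb vector field of `f λ₁` in Cartesian coordinates. This extension to the ambient space is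
tangent to all the cylinders `ℝ × {|x| = const}`. -/
noncomputable def reebField (f : ℝ → ℝ) (p : Amb) : Amb :=
  (f p.1 ^ 2 * (2 * p.2 2 ^ 2 + 1))⁻¹ • (f p.1 * p.2 2,
    !₂[-(1 / 2) * deriv f p.1 * p.2 0 * p.2 2 - (2 * f p.1 - p.1 * deriv f p.1) * p.2 1,
      -(1 / 2) * deriv f p.1 * p.2 1 * p.2 2 + (2 * f p.1 - p.1 * deriv f p.1) * p.2 0,
      1 / 2 * deriv f p.1 * (p.2 0 ^ 2 + p.2 1 ^ 2)])

theorem reebField_fst (hpos : ∀ ρ, 0 < f ρ) (p : Amb) :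
    (reebField f p).1 = p.2 2 / (f p.1 * (2 * p.2 2 ^ 2 + 1)) := by
  have := (hpos p.1).ne'
  simp [reebField]
  field_simp

theorem contDiff_reebField (hf : ContDiff ℝ ∞ f) (hpos : ∀ ρ, 0 < f ρ) :
    ContDiff ℝ ∞ (reebField f) := by
  have hf' : ContDiff ℝ ∞ (deriv f) := ((contDiff_infty_iff_deriv).1 hf).2
  have h1 : ContDiff ℝ ∞ (fun p : Amb => f p.1) := hf.comp contDiff_fst
  have h2 : ContDiff ℝ ∞ (fun p : Amb => deriv f p.1) := hf'.comp contDiff_fst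
  have h3 : ∀ i, ContDiff ℝ ∞ (fun p : Amb => p.2 i) := fun i => (coordX i).contDiff
  have h0 := h3 0
  have h1' := h3 1
  have h2' := h3 2
  have h4 : ContDiff ℝ ∞ (fun p : Amb => f p.1 ^ 2 * (2 * p.2 2 ^ 2 + 1)) := by fun_prop
  refine ContDiff.smul (h4.inv fun p => ?_) (ContDiff.prodMk (h1.mul h2') ?_)
  · have := hpos p.1
    positivity
  · rw [contDiff_euclidean]
    intro i
    fin_cases i <;> simp <;> fun_prop

theorem isReebVector_reebField (hf : Differentiable ℝ f) (hpos : ∀ ρ, 0 < f ρ) {p : Amb}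
    (hp : p ∈ neck) : IsReebVector (lambdaF f) p (reebField f p) := by
  rw [mem_neck_iff] at hp
  have hf0 := (hpos p.1).ne'
  have hg : 2 * p.2 2 ^ 2 + 1 ≠ 0 := by positivity
  have hone : lambdaOne p (reebField f p) = (f p.1)⁻¹ := by
    rw [lambdaOne_apply]
    simp [reebField]
    field_simp
    have : p.2 0 ^ 2 + p.2 1 ^ 2 = 1 - p.2 2 ^ 2 := by linarith
    linear_combination (4 * f p.1) * this
  refine ⟨?_, ?_, fun w hw => ?_⟩
  · rw [mem_tangentNeck_iff]
    simp [reebField]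
    ring
  · rw [lambdaF_apply, hone, mul_inv_cancel₀ hf0]
  · rw [mem_tangentNeck_iff] at hw
    rw [formD_lambdaF hf, hone, lambdaOne_apply]
    simp [reebField]
    field_simp
    linear_combination (-2 * (2 * f p.1 - p.1 * deriv f p.1)) * hw + 2 * deriv f p.1 * w.1 * hp

/-- The `ρ`- and `x₂`-components of a Reeb vector of `f λ₁`. -/
theorem IsReebVector.components (hf : Differentiable ℝ f) (hpos : ∀ ρ, 0 < f ρ) {p X : Amb}
    (hp : p ∈ neck) (hX : IsReebVector (lambdaF f) p X) :
    X.1 = p.2 2 / (f p.1 * (2 * p.2 2 ^ 2 + 1)) ∧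
      X.2 2 = deriv f p.1 * (1 - p.2 2 ^ 2) / (2 * f p.1 ^ 2 * (2 * p.2 2 ^ 2 + 1)) := by
  rw [mem_neck_iff] at hp
  have hf0 := hpos p.1
  have hg : 0 < 2 * p.2 2 ^ 2 + 1 := by positivity
  have ht := mem_tangentNeck_iff.1 hX.tangent
  have h1 := hX.form_eq_one
  -- contraction of `dα` with `∂_ρ`, `∂_φ` and `-sin θ ∂_θ`
  have hr := hX.contract_eq_zero (1, 0) (by simp [mem_tangentNeck_iff])
  have hφ := hX.contract_eq_zero (0, !₂[-p.2 1, p.2 0, 0])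
    (by simp [mem_tangentNeck_iff]; ring)
  have hθ := hX.contract_eq_zero
    (0, !₂[-p.2 0 * p.2 2, -p.2 1 * p.2 2, p.2 0 ^ 2 + p.2 1 ^ 2])
    (by simp [mem_tangentNeck_iff]; ring)
  rw [lambdaF_apply, lambdaOne_apply] at h1
  rw [formD_lambdaF hf, lambdaOne_apply, lambdaOne_apply] at hr hφ hθ
  simp at hr hφ hθ
  have e1 : X.1 * (f p.1 * (2 * p.2 2 ^ 2 + 1)) = p.2 2 := by
    linear_combination p.2 2 * h1 - 1 / 2 * hθ + p.1 * (hφ - f p.1 * ht) - f p.1 * X.1 * hp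
  have e1' : X.1 = p.2 2 / (f p.1 * (2 * p.2 2 ^ 2 + 1)) := by
    rw [eq_div_iff (by positivity), e1]
  refine ⟨e1', ?_⟩
  rw [eq_div_iff (by positivity)]
  linear_combination (2 * p.2 2 ^ 2 + 1) * (f p.1 * hr + deriv f p.1 * h1)
    - 3 * deriv f p.1 * p.2 2 * e1

/-- The Reeb vectors at the points of the equator. -/
theorem IsReebVector.equatorial (hpos : ∀ ρ, 0 < f ρ) {p X : Amb}
    (hp : p ∈ neck) (h0 : p.1 = 0) (hz : p.2 2 = 0) (hX : IsReebVector (lambdaF f) p X) :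
    X.2 0 = -(2 / f 0) * p.2 1 ∧ X.2 1 = 2 / f 0 * p.2 0 := by
  rw [mem_neck_iff, hz] at hp
  have ht := mem_tangentNeck_iff.1 hX.tangent
  have h1 := hX.form_eq_one
  rw [lambdaF_apply, lambdaOne_apply, h0, hz] at h1
  rw [hz] at ht
  have hf0 := (hpos 0).ne'
  have h2 : p.2 0 * X.2 1 - p.2 1 * X.2 0 = 2 / f 0 := by
    field_simp
    linear_combination 2 * h1
  constructor
  · linear_combination (-p.2 1) * h2 + p.2 0 * ht - X.2 0 * hp
  · linear_combination p.2 0 * h2 + p.2 1 * ht - X.2 1 * hp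

theorem deriv_zero_of_mul_deriv_pos (hf : ContDiff ℝ ∞ f)
    (hmono : ∀ ρ, ρ ≠ 0 → 0 < ρ * deriv f ρ) : deriv f 0 = 0 := by
  have hc : Continuous (deriv f) := (contDiff_infty_iff_deriv.1 hf).2.continuous
  have hR : 0 ≤ deriv f 0 := by
    refine ge_of_tendsto (hc.continuousWithinAt (s := Ioi 0) (x := 0)) ?_
    filter_upwards [self_mem_nhdsWithin] with x hx
    exact (pos_of_mul_pos_right (hmono x (ne_of_gt hx)) (le_of_lt hx)).le
  have hL : deriv f 0 ≤ 0 := by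
    refine le_of_tendsto (hc.continuousWithinAt (s := Iio 0) (x := 0)) ?_
    filter_upwards [self_mem_nhdsWithin] with x hx
    exact (neg_of_mul_pos_right (hmono x (ne_of_lt hx)) (le_of_lt hx)).le
  exact le_antisymm hL hR

theorem le_of_mul_deriv_pos (hf : ContDiff ℝ ∞ f)
    (hmono : ∀ ρ, ρ ≠ 0 → 0 < ρ * deriv f ρ) (ρ : ℝ) : f 0 ≤ f ρ := by
  have hd : Differentiable ℝ f := hf.differentiable (by simp)
  rcases le_total 0 ρ with h | h
  · refine monotoneOn_of_deriv_nonneg (convex_Ici 0) hd.continuous.continuousOn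
      hd.differentiableOn (fun x hx => ?_) self_mem_Ici h h
    rw [interior_Ici] at hx
    exact (pos_of_mul_pos_right (hmono x (ne_of_gt hx)) (le_of_lt hx)).le
  · refine antitoneOn_of_deriv_nonpos (convex_Iic 0) hd.continuous.continuousOn
      hd.differentiableOn (fun x hx => ?_) h self_mem_Iic h
    rw [interior_Iic] at hx
    exact (neg_of_mul_pos_right (hmono x (ne_of_lt hx)) (le_of_lt hx)).le

/-- Along the Reeb flow `ρ x₂` is nondecreasing, and it is stationary only on the equator
`ρ = x₂ = 0`. -/
theorem IsReebVector.rho_mul_height (hf : Differentiable ℝ f) (hpos : ∀ ρ, 0 < f ρ)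
    (hmono : ∀ ρ, ρ ≠ 0 → 0 < ρ * deriv f ρ) {p X : Amb}
    (hp : p ∈ neck) (hX : IsReebVector (lambdaF f) p X) :
    0 ≤ X.1 * p.2 2 + p.1 * X.2 2 ∧
      (X.1 * p.2 2 + p.1 * X.2 2 = 0 → p.1 = 0 ∧ p.2 2 = 0) := by
  obtain ⟨h1, h2⟩ := hX.components hf hpos hp
  rw [mem_neck_iff] at hp
  have hf0 := hpos p.1
  have hg : 0 < 2 * p.2 2 ^ 2 + 1 := by positivity
  have hz : 0 ≤ 1 - p.2 2 ^ 2 := by nlinarith [sq_nonneg (p.2 0), sq_nonneg (p.2 1)]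
  have hA : 0 ≤ p.2 2 ^ 2 / (f p.1 * (2 * p.2 2 ^ 2 + 1)) := by positivity
  have hm : 0 ≤ p.1 * deriv f p.1 := by
    by_cases h : p.1 = 0
    · simp [h]
    · exact (hmono _ h).le
  have hB : 0 ≤ p.1 * deriv f p.1 * (1 - p.2 2 ^ 2) / (2 * f p.1 ^ 2 * (2 * p.2 2 ^ 2 + 1)) := by
    positivity
  have e : X.1 * p.2 2 + p.1 * X.2 2 = p.2 2 ^ 2 / (f p.1 * (2 * p.2 2 ^ 2 + 1)) +
      p.1 * deriv f p.1 * (1 - p.2 2 ^ 2) / (2 * f p.1 ^ 2 * (2 * p.2 2 ^ 2 + 1)) := by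
    rw [h1, h2]; ring
  rw [e]
  refine ⟨add_nonneg hA hB, fun h => ?_⟩
  have hz0 : p.2 2 = 0 := by
    have := ((add_eq_zero_iff_of_nonneg hA hB).1 h).1
    rw [div_eq_zero_iff] at this
    exact pow_eq_zero_iff two_ne_zero |>.1 (this.resolve_right (by positivity))
  refine ⟨?_, hz0⟩
  by_contra hne
  have := ((add_eq_zero_iff_of_nonneg hA hB).1 h).2
  rw [hz0] at this
  have h3 := hmono _ hne
  have : 0 < p.1 * deriv f p.1 * (1 - 0 ^ 2) / (2 * f p.1 ^ 2 * (2 * 0 ^ 2 + 1)) := by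
    norm_num
    positivity
  linarith

theorem reebField_of_equatorial (hpos : ∀ ρ, 0 < f ρ) (hf0 : deriv f 0 = 0) {p : Amb}
    (h0 : p.1 = 0) (hz : p.2 2 = 0) :
    reebField f p = (0, !₂[-(2 / f 0) * p.2 1, 2 / f 0 * p.2 0, 0]) := by
  have := (hpos 0).ne'
  apply amb_ext <;> simp [reebField, h0, hz, hf0] <;> field_simp

end ReebField

/-! ### Periodic Reeb orbits -/

section PeriodicOrbits

variable {f : ℝ → ℝ}

theorem equator_eq (t : ℝ) : equator t =
    (0, !₂[Real.cos (2 * Real.pi * t), Real.sin (2 * Real.pi * t), 0]) := by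
  simp [equator, sph]

theorem equator_mem_neck (t : ℝ) : equator t ∈ neck := by
  rw [mem_neck_iff, equator_eq]
  simp [Real.cos_sq_add_sin_sq]

theorem isSimpleReebOrbit_equator (hf : ContDiff ℝ ∞ f) (hpos : ∀ ρ, 0 < f ρ)
    (hf0 : deriv f 0 = 0) : IsSimpleReebOrbit (lambdaF f) (Real.pi * f 0) equator where
  period_pos := mul_pos Real.pi_pos (hpos 0)
  periodic t := by
    rw [equator_eq, equator_eq, mul_add, mul_one, Real.cos_add_two_pi, Real.sin_add_two_pi]
  mem := equator_mem_neck
  deriv t := by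
    refine ⟨_, isReebVector_reebField (hf.differentiable (by simp)) hpos (equator_mem_neck t), ?_⟩
    have hl : HasDerivAt (fun s => 2 * Real.pi * s) (2 * Real.pi) t := by
      simpa using (hasDerivAt_id t).const_mul (2 * Real.pi)
    have h := (hasDerivAt_const t (0 : ℝ)).prodMk
      (hasDerivAt_vec3 hl.cos hl.sin (hasDerivAt_const t (0 : ℝ)))
    rw [reebField_of_equatorial hpos hf0 (by simp [equator_eq]) (by simp [equator_eq])]
    have hne := (hpos 0).ne'
    refine (h.congr_of_eventuallyEq (.of_forall equator_eq)).congr_deriv ?_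
    apply amb_ext <;> simp [equator_eq] <;> field_simp
  simple s t h := by
    rw [equator_eq, equator_eq] at h
    have hc : Real.cos (2 * Real.pi * s) = Real.cos (2 * Real.pi * t) := by
      simpa using congrArg (fun p : Amb => p.2 0) h
    have hs : Real.sin (2 * Real.pi * s) = Real.sin (2 * Real.pi * t) := by
      simpa using congrArg (fun p : Amb => p.2 1) h
    have h1 : Real.cos (2 * Real.pi * t - 2 * Real.pi * s) = 1 := by
      rw [Real.cos_sub, hc, hs]
      linarith [Real.cos_sq_add_sin_sq (2 * Real.pi * t)]
    obtain ⟨n, hn⟩ := (Real.cos_eq_one_iff _).1 h1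
    refine ⟨n, ?_⟩
    have := Real.pi_pos
    field_simp at hn
    linarith

/-- A periodic Reeb orbit stays on the equator, because the function `ρ x₂` is both monotone and
periodic along it. -/
theorem IsPeriodicReebOrbit.equatorial (hf : ContDiff ℝ ∞ f) (hpos : ∀ ρ, 0 < f ρ)
    (hmono : ∀ ρ, ρ ≠ 0 → 0 < ρ * _root_.deriv f ρ) {T : ℝ} {γ : ℝ → Amb}
    (hγ : IsPeriodicReebOrbit (lambdaF f) T γ) (t : ℝ) : (γ t).1 = 0 ∧ (γ t).2 2 = 0 := by
  have hdf : Differentiable ℝ f := hf.differentiable (by simp)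
  choose X hX hd using hγ.deriv
  have hh : ∀ t, HasDerivAt (fun s => (γ s).1 * (γ s).2 2)
      (T * ((X t).1 * (γ t).2 2 + (γ t).1 * (X t).2 2)) t := fun t => by
    obtain ⟨h1, h2⟩ := hasDerivAt_amb_iff.1 (hd t)
    refine (h1.mul (h2 2)).congr_deriv ?_
    simp
    ring
  have hm : Monotone (fun s => (γ s).1 * (γ s).2 2) :=
    monotone_of_deriv_nonneg (fun t => (hh t).differentiableAt) fun t => by
      rw [(hh t).deriv]
      exact mul_nonneg hγ.period_pos.le ((hX t).rho_mul_height hdf hpos hmono (hγ.mem t)).1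
  have hper : Function.Periodic (fun s => (γ s).1 * (γ s).2 2) 1 := fun s => by
    simp [hγ.periodic s]
  have hconst : ∀ a b, a ≤ b → (γ a).1 * (γ a).2 2 = (γ b).1 * (γ b).2 2 := by
    intro a b hab
    refine le_antisymm (hm hab) ?_
    obtain ⟨n, hn⟩ := exists_nat_ge (b - a)
    refine (hm (show b ≤ a + n * 1 by linarith)).trans (le_of_eq ?_)
    exact hper.nat_mul n a
  have h0 : T * ((X t).1 * (γ t).2 2 + (γ t).1 * (X t).2 2) = 0 := by
    refine (hh t).unique ((hasDerivAt_const t ((γ t).1 * (γ t).2 2)).congr_of_eventuallyEq ?_)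
    refine .of_forall fun s => ?_
    rcases le_total s t with h | h
    · exact hconst _ _ h
    · exact (hconst _ _ h).symm
  exact ((hX t).rho_mul_height hdf hpos hmono (hγ.mem t)).2
    ((mul_eq_zero.1 h0).resolve_left hγ.period_pos.ne')

theorem IsSimpleReebOrbit.eq_equator (hf : ContDiff ℝ ∞ f) (hpos : ∀ ρ, 0 < f ρ)
    (hmono : ∀ ρ, ρ ≠ 0 → 0 < ρ * deriv f ρ) {T : ℝ} {γ : ℝ → Amb}
    (hγ : IsSimpleReebOrbit (lambdaF f) T γ) :
    T = Real.pi * f 0 ∧ ∃ s, ∀ t, γ t = equator (t + s) := by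
  have heq := hγ.toIsPeriodicReebOrbit.equatorial hf hpos hmono
  have hT := hγ.period_pos
  have hf0 := hpos 0
  set c := 2 * T / f 0 with hc
  have hc0 : 0 < c := by positivity
  have hx : ∀ t, HasDerivAt (fun s => (γ s).2 0) (-c * (γ t).2 1) t := fun t => by
    obtain ⟨X, hX, hd⟩ := hγ.deriv t
    refine ((hasDerivAt_amb_iff.1 hd).2 0).congr_deriv ?_
    simp [(hX.equatorial hpos (hγ.mem t) (heq t).1 (heq t).2).1, hc]
    ring
  have hy : ∀ t, HasDerivAt (fun s => (γ s).2 1) (c * (γ t).2 0) t := fun t => by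
    obtain ⟨X, hX, hd⟩ := hγ.deriv t
    refine ((hasDerivAt_amb_iff.1 hd).2 1).congr_deriv ?_
    simp [(hX.equatorial hpos (hγ.mem t) (heq t).1 (heq t).2).2, hc]
    ring
  have hl : ∀ t, HasDerivAt (fun s => c * s) c t := fun t => by
    simpa using (hasDerivAt_id t).const_mul c
  -- rotating back by the angle `c t` gives a constant
  have ha : ∀ t, (γ t).2 0 * Real.cos (c * t) + (γ t).2 1 * Real.sin (c * t) = (γ 0).2 0 := by
    intro t
    have hd : ∀ t, HasDerivAt
        (fun t => (γ t).2 0 * Real.cos (c * t) + (γ t).2 1 * Real.sin (c * t)) 0 t := fun t =>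
      (((hx t).mul (hl t).cos).add ((hy t).mul (hl t).sin)).congr_deriv (by ring)
    have := is_const_of_deriv_eq_zero (fun t => (hd t).differentiableAt) (fun t => (hd t).deriv) t 0
    simpa using this
  have hb : ∀ t, (γ t).2 1 * Real.cos (c * t) - (γ t).2 0 * Real.sin (c * t) = (γ 0).2 1 := by
    intro t
    have hd : ∀ t, HasDerivAt
        (fun t => (γ t).2 1 * Real.cos (c * t) - (γ t).2 0 * Real.sin (c * t)) 0 t := fun t =>
      (((hy t).mul (hl t).cos).sub ((hx t).mul (hl t).sin)).congr_deriv (by ring)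
    have := is_const_of_deriv_eq_zero (fun t => (hd t).differentiableAt) (fun t => (hd t).deriv) t 0
    simpa using this
  have hx' : ∀ t, (γ t).2 0 = (γ 0).2 0 * Real.cos (c * t) - (γ 0).2 1 * Real.sin (c * t) := by
    intro t
    linear_combination Real.cos (c * t) * ha t - Real.sin (c * t) * hb t
      - (γ t).2 0 * Real.cos_sq_add_sin_sq (c * t)
  have hy' : ∀ t, (γ t).2 1 = (γ 0).2 0 * Real.sin (c * t) + (γ 0).2 1 * Real.cos (c * t) := by
    intro t
    linear_combination Real.sin (c * t) * ha t + Real.cos (c * t) * hb t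
      - (γ t).2 1 * Real.cos_sq_add_sin_sq (c * t)
  have hn := mem_neck_iff.1 (hγ.mem 0)
  rw [(heq 0).2] at hn
  have hext : ∀ s t, Real.cos (c * s) = Real.cos (c * t) → Real.sin (c * s) = Real.sin (c * t) →
      γ s = γ t := fun s t h h' => by
    apply amb_ext
    · rw [(heq s).1, (heq t).1]
    · rw [hx', hx' t, h, h']
    · rw [hy', hy' t, h, h']
    · rw [(heq s).2, (heq t).2]
  have hcos : Real.cos c = 1 := by
    have h1 : γ 1 = γ 0 := by simpa using hγ.periodic 0
    have h2 := hx' 1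
    have h3 := hy' 1
    rw [h1, mul_one] at h2 h3
    linear_combination (-Real.cos c + 1) * hn - (γ 0).2 0 * h2 - (γ 0).2 1 * h3
  obtain ⟨k, hk⟩ := (Real.cos_eq_one_iff _).1 hcos
  have hpi := Real.pi_pos
  have hk0 : (0 : ℝ) < k := by
    by_contra! h
    nlinarith
  -- `γ (1 / k) = γ 0`, so injectivity on `ℝ / ℤ` forces `k = 1`
  have hk1 : k = 1 := by
    have hck : c * (1 / k) = 2 * Real.pi := by
      rw [← hk]; field_simp
    obtain ⟨n, hn⟩ := hγ.simple 0 (1 / k)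
      (hext _ _ (by rw [hck]; simp) (by rw [hck]; simp))
    rw [zero_add, div_eq_iff hk0.ne'] at hn
    have : n * k = 1 := by exact_mod_cast hn.symm
    rcases Int.mul_eq_one_iff_eq_one_or_neg_one.1 this with h | h
    · exact h.2
    · rw [h.2] at hk0
      norm_num at hk0
  have hc2 : c = 2 * Real.pi := by simpa [hk1] using hk.symm
  refine ⟨?_, ?_⟩
  · rw [hc, div_eq_iff hf0.ne'] at hc2
    linarith
  · obtain ⟨φ, hφ, hφ'⟩ : ∃ φ, (γ 0).2 0 = Real.cos φ ∧ (γ 0).2 1 = Real.sin φ := by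
      have hz : ‖(⟨(γ 0).2 0, (γ 0).2 1⟩ : ℂ)‖ = 1 := by
        rw [← sq_eq_sq₀ (norm_nonneg _) zero_le_one, ← Complex.normSq_eq_norm_sq,
          Complex.normSq_mk]
        linarith
      have hz0 : (⟨(γ 0).2 0, (γ 0).2 1⟩ : ℂ) ≠ 0 := by
        rw [← norm_ne_zero_iff, hz]; exact one_ne_zero
      refine ⟨Complex.arg ⟨(γ 0).2 0, (γ 0).2 1⟩, ?_, ?_⟩
      · rw [Complex.cos_arg hz0, hz, div_one]
      · rw [Complex.sin_arg, hz, div_one]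
    refine ⟨φ / (2 * Real.pi), fun t => ?_⟩
    have harg : 2 * Real.pi * (t + φ / (2 * Real.pi)) = φ + c * t := by
      rw [hc2]; field_simp; ring
    rw [equator_eq, harg]
    apply amb_ext
    · simp [(heq t).1]
    · simp [hx' t, hφ, hφ', Real.cos_add]
    · simp [hy' t, hφ, hφ', Real.sin_add]; ring
    · simp [(heq t).2]

end PeriodicOrbits

/-! ### The Reeb flow and its linearization along the equator -/

section Flow

variable {f : ℝ → ℝ}

/-- A curve with velocity proportional to the Reeb field stays on `ℝ × S²`, and its `ρ`-coordinate
has speed at most `1 / f 0`. -/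
theorem mem_neck_of_hasDerivAt_smul_reebField (hf : ContDiff ℝ ∞ f) (hpos : ∀ ρ, 0 < f ρ)
    (hmono : ∀ ρ, ρ ≠ 0 → 0 < ρ * deriv f ρ) {α : ℝ → Amb} {χ : ℝ → ℝ} {N : ℝ} (hN : 0 < N)
    (h0 : α 0 ∈ neck) (hχ : ∀ t, χ t ∈ Icc (0 : ℝ) 1)
    (hα : ∀ t ∈ Ioo (-N) N, HasDerivAt α (χ t • reebField f (α t)) t) :
    ∀ t ∈ Ioo (-N) N, α t ∈ neck ∧ ‖α t‖ ≤ |(α 0).1| + N / f 0 + 1 := by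
  intro t ht
  have h0N : (0 : ℝ) ∈ Ioo (-N) N := by simp [hN]
  have hfst : ‖(α t).1 - (α 0).1‖ ≤ 1 / f 0 * ‖t - 0‖ := by
    refine (convex_Ioo (-N) N).norm_image_sub_le_of_norm_hasDerivWithin_le
      (fun s hs => (hasDerivAt_amb_iff.1 (hα s hs)).1.hasDerivWithinAt) (fun s hs => ?_) h0N ht
    have hf0 := hpos 0
    have hle := le_of_mul_deriv_pos hf hmono (α s).1
    rw [Prod.smul_fst, reebField_fst hpos, smul_eq_mul, norm_mul, Real.norm_of_nonneg (hχ s).1]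
    have hg : |(α s).2 2| ≤ 2 * (α s).2 2 ^ 2 + 1 := by
      rw [abs_le]
      constructor <;> nlinarith [sq_nonneg ((α s).2 2 - 1), sq_nonneg ((α s).2 2 + 1)]
    calc χ s * ‖(α s).2 2 / (f (α s).1 * (2 * (α s).2 2 ^ 2 + 1))‖
        ≤ 1 * ‖(α s).2 2 / (f (α s).1 * (2 * (α s).2 2 ^ 2 + 1))‖ := by
          gcongr; exact (hχ s).2
      _ = |(α s).2 2| / (f (α s).1 * (2 * (α s).2 2 ^ 2 + 1)) := by
          rw [one_mul, norm_div, Real.norm_eq_abs, Real.norm_of_nonneg (by positivity [hpos (α s).1])]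
      _ ≤ (2 * (α s).2 2 ^ 2 + 1) / (f 0 * (2 * (α s).2 2 ^ 2 + 1)) := by gcongr
      _ = 1 / f 0 := by field_simp
  have hsnd : ‖((α t).2 0 ^ 2 + (α t).2 1 ^ 2 + (α t).2 2 ^ 2) -
      ((α 0).2 0 ^ 2 + (α 0).2 1 ^ 2 + (α 0).2 2 ^ 2)‖ ≤ 0 * ‖t - 0‖ := by
    refine (convex_Ioo (-N) N).norm_image_sub_le_of_norm_hasDerivWithin_le
      (f := fun t => (α t).2 0 ^ 2 + (α t).2 1 ^ 2 + (α t).2 2 ^ 2) (f' := fun _ => 0)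
      (fun s hs => HasDerivAt.hasDerivWithinAt ?_) (fun s hs => by simp) h0N ht
    have h := (hasDerivAt_amb_iff.1 (hα s hs)).2
    refine ((((h 0).pow 2).add ((h 1).pow 2)).add ((h 2).pow 2)).congr_deriv ?_
    simp [reebField]
    ring
  have hmem : α t ∈ neck := by
    rw [mem_neck_iff] at h0 ⊢
    rw [zero_mul, norm_le_zero_iff, sub_eq_zero] at hsnd
    rw [hsnd, h0]
  refine ⟨hmem, ?_⟩
  have hn : ‖(α t).2‖ = 1 := by simpa [neck] using hmem
  have hf0 := hpos 0
  have h1 : |t| ≤ N := (abs_lt.2 ht).le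
  have h2 : |(α t).1| ≤ |(α 0).1| + N / f 0 := by
    have h3 := abs_sub_abs_le_abs_sub (α t).1 (α 0).1
    rw [sub_zero, Real.norm_eq_abs, Real.norm_eq_abs] at hfst
    have h4 : 1 / f 0 * |t| ≤ N / f 0 := by
      rw [one_div_mul_eq_div]; gcongr
    linarith
  rw [Prod.norm_def, hn, Real.norm_eq_abs]
  refine max_le (by linarith) ?_
  have : 0 ≤ |(α 0).1| + N / f 0 := by positivity
  linarith

theorem exists_reeb_trajectory (hf : ContDiff ℝ ∞ f) (hpos : ∀ ρ, 0 < f ρ)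
    (hmono : ∀ ρ, ρ ≠ 0 → 0 < ρ * deriv f ρ) {p : Amb} (hp : p ∈ neck) :
    ∃ γ : ℝ → Amb, γ 0 = p ∧ ∀ t, HasDerivAt γ (reebField f (γ t)) t := by
  refine exists_global_solution ((contDiff_reebField hf hpos).of_le (by simp)) p
    (fun N => |p.1| + N / f 0 + 1) fun N hN χ hχ α hα0 hα t ht => ?_
  have := (mem_neck_of_hasDerivAt_smul_reebField hf hpos hmono (χ := fun t => χ (α t)) hN
    (by rwa [hα0]) (fun t => hχ _) hα t ht).2
  rwa [hα0] at this

/-- The linearized Reeb flow along the equator, as a family of maps of the ambient space: a rotation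
by the angle `2t / F` in the plane of the equator and a hyperbolic rotation in the `(ρ, x₂)`-plane.
Here `F = f 0`, and `κ` is the exponential rate `(f'' 0 / (2 F³))^(1/2)`. -/
noncomputable def linFlow (F κ t : ℝ) : Amb →L[ℝ] Amb :=
  LinearMap.toContinuousLinearMap
    { toFun := fun h => (Real.cosh (κ * t) * h.1 + Real.sinh (κ * t) / (κ * F) * h.2 2,
        !₂[Real.cos (2 / F * t) * h.2 0 - Real.sin (2 / F * t) * h.2 1,
          Real.sin (2 / F * t) * h.2 0 + Real.cos (2 / F * t) * h.2 1,
          κ * F * Real.sinh (κ * t) * h.1 + Real.cosh (κ * t) * h.2 2])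
      map_add' := fun u w => by apply amb_ext <;> simp <;> ring
      map_smul' := fun c u => by apply amb_ext <;> simp <;> ring }

theorem linFlow_apply (F κ t : ℝ) (h : Amb) : linFlow F κ t h =
    (Real.cosh (κ * t) * h.1 + Real.sinh (κ * t) / (κ * F) * h.2 2,
        !₂[Real.cos (2 / F * t) * h.2 0 - Real.sin (2 / F * t) * h.2 1,
          Real.sin (2 / F * t) * h.2 0 + Real.cos (2 / F * t) * h.2 1,
          κ * F * Real.sinh (κ * t) * h.1 + Real.cosh (κ * t) * h.2 2]) := rfl

/-- The linearization of the Reeb field is the same at all points of the equator. -/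
theorem fderiv_reebField_equatorial (hf : ContDiff ℝ ∞ f) (hpos : ∀ ρ, 0 < f ρ)
    (hf0 : deriv f 0 = 0) {p : Amb} (hp : p ∈ neck) (h0 : p.1 = 0) (hz : p.2 2 = 0) (h : Amb) :
    fderiv ℝ (reebField f) p h = (h.2 2 / f 0, !₂[-(2 / f 0) * h.2 1, 2 / f 0 * h.2 0,
      deriv (deriv f) 0 / (2 * f 0 ^ 2) * h.1]) := by
  rw [mem_neck_iff, hz] at hp
  have hne := (hpos 0).ne'
  have hline : HasDerivAt (fun s : ℝ => p + s • h) h 0 := by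
    simpa using ((hasDerivAt_id (0 : ℝ)).smul_const h).const_add p
  have hV : HasFDerivAt (reebField f) (fderiv ℝ (reebField f) p) (p + (0 : ℝ) • h) := by
    simpa using ((contDiff_reebField hf hpos).differentiable (by simp) p).hasFDerivAt
  refine (hV.comp_hasDerivAt (0 : ℝ) hline).unique ?_
  have hlin : ∀ a b : ℝ, HasDerivAt (fun s : ℝ => a + s * b) b 0 := fun a b => by
    simpa using ((hasDerivAt_id (0 : ℝ)).mul_const b).const_add a
  have hr : HasDerivAt (fun s : ℝ => s * h.1) h.1 0 := by simpa using hlin 0 h.1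
  have hz' : HasDerivAt (fun s : ℝ => s * h.2 2) (h.2 2) 0 := by simpa using hlin 0 (h.2 2)
  have hx := hlin (p.2 0) (h.2 0)
  have hy := hlin (p.2 1) (h.2 1)
  have hfr : HasDerivAt (fun s : ℝ => f (s * h.1)) 0 0 := by
    have h1 : HasDerivAt f 0 (0 * h.1) := by
      simpa [hf0] using (hf.differentiable (by simp) 0).hasDerivAt
    exact (h1.comp (0 : ℝ) hr).congr_deriv (zero_mul _)
  have hfr' : HasDerivAt (fun s : ℝ => deriv f (s * h.1)) (deriv (deriv f) 0 * h.1) 0 := by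
    have hd : Differentiable ℝ (deriv f) :=
      (contDiff_infty_iff_deriv.1 hf).2.differentiable (by simp)
    have h1 : HasDerivAt (deriv f) (deriv (deriv f) 0) (0 * h.1) := by
      simpa using (hd 0).hasDerivAt
    exact h1.comp (0 : ℝ) hr
  have hN : HasDerivAt (fun s : ℝ => (f (s * h.1) ^ 2 * (2 * (s * h.2 2) ^ 2 + 1))⁻¹) 0 0 := by
    refine (((hfr.pow 2).mul (((hz'.pow 2).const_mul 2).add_const 1)).inv ?_).congr_deriv ?_
    · simpa using hne
    · simp
  have hm : HasDerivAt (fun s : ℝ => 2 * f (s * h.1) - s * h.1 * deriv f (s * h.1)) 0 0 := by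
    refine ((hfr.const_mul 2).sub (hr.mul hfr')).congr_deriv ?_
    simp [hf0]
  rw [hasDerivAt_amb_iff]
  refine ⟨?_, fun i => ?_⟩
  · refine ((hN.mul (hfr.mul hz')).congr_of_eventuallyEq (.of_forall fun s => ?_)).congr_deriv ?_
    · simp [reebField, h0, hz]
    · simp
      field_simp
  · fin_cases i
    · refine ((hN.mul ((((hfr'.const_mul (-(1 / 2))).mul hx).mul hz').sub
        (hm.mul hy))).congr_of_eventuallyEq (.of_forall fun s => ?_)).congr_deriv ?_
      · simp [reebField, h0, hz]
      · simp [hf0]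
        field_simp
    · refine ((hN.mul ((((hfr'.const_mul (-(1 / 2))).mul hy).mul hz').add
        (hm.mul hx))).congr_of_eventuallyEq (.of_forall fun s => ?_)).congr_deriv ?_
      · simp [reebField, h0, hz]
      · simp [hf0]
        field_simp
    · refine ((hN.mul ((hfr'.const_mul (1 / 2)).mul ((hx.pow 2).add
        (hy.pow 2)))).congr_of_eventuallyEq (.of_forall fun s => ?_)).congr_deriv ?_
      · simp [reebField, h0, hz]
      · have hp' : p.2 0 ^ 2 + p.2 1 ^ 2 = 1 := by linarith
        simp [hf0, hp']
        field_simp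

theorem hasDerivAt_linFlow {F κ : ℝ} (hF : F ≠ 0) (hκ : κ ≠ 0) (h : Amb) (t : ℝ) :
    HasDerivAt (fun s => linFlow F κ s h) ((linFlow F κ t h).2 2 / F,
      !₂[-(2 / F) * (linFlow F κ t h).2 1, 2 / F * (linFlow F κ t h).2 0,
        κ ^ 2 * F * (linFlow F κ t h).1]) t := by
  have hl : ∀ c : ℝ, HasDerivAt (fun s => c * s) c t := fun c => by
    simpa using (hasDerivAt_id t).const_mul c
  refine (((hl κ).cosh.mul_const h.1).add (((hl κ).sinh.div_const (κ * F)).mul_const (h.2 2))).prodMk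
    (hasDerivAt_vec3
      (((hl (2 / F)).cos.mul_const (h.2 0)).sub ((hl (2 / F)).sin.mul_const (h.2 1)))
      (((hl (2 / F)).sin.mul_const (h.2 0)).add ((hl (2 / F)).cos.mul_const (h.2 1)))
      ((((hl κ).sinh.const_mul (κ * F)).mul_const h.1).add ((hl κ).cosh.mul_const (h.2 2))))
    |>.congr_deriv ?_
  apply amb_ext <;> simp [linFlow_apply] <;> field_simp <;> ring

/-- The Reeb flow of `f λ₁`, with its derivative at a point of the equator. -/
theorem exists_reebFlow (hf : ContDiff ℝ ∞ f) (hpos : ∀ ρ, 0 < f ρ)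
    (hmono : ∀ ρ, ρ ≠ 0 → 0 < ρ * deriv f ρ) {κ : ℝ} (hκ : 0 < κ)
    (hκ2 : κ ^ 2 = deriv (deriv f) 0 / (2 * f 0 ^ 3)) :
    ∃ ψ, IsReebFlow (lambdaF f) ψ ∧
      ∀ t, 0 ≤ t → HasFDerivWithinAt (ψ t) (linFlow (f 0) κ t) neck (equator 0) := by
  have hne := (hpos 0).ne'
  have hf0 := deriv_zero_of_mul_deriv_pos hf hmono
  have hV := contDiff_reebField hf hpos
  choose! γ hγ0 hγ using fun p (hp : p ∈ neck) => exists_reeb_trajectory hf hpos hmono hp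
  have hb : ∀ p ∈ neck, ∀ N > 0, ∀ t ∈ Ioo (-N) N,
      γ p t ∈ neck ∧ ‖γ p t‖ ≤ |p.1| + N / f 0 + 1 := by
    intro p hp N hN t ht
    have := mem_neck_of_hasDerivAt_smul_reebField hf hpos hmono (χ := fun _ => 1) hN
      (α := γ p) (by rwa [hγ0 p hp]) (fun t => by simp)
      (fun t _ => by simpa using hγ p hp t) t ht
    rwa [hγ0 p hp] at this
  have hmem : ∀ p ∈ neck, ∀ t, γ p t ∈ neck := fun p hp t =>
    (hb p hp (|t| + 1) (by positivity) t (abs_lt.1 (lt_add_one _))).1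
  refine ⟨fun t p => γ p t, ⟨hγ0, hmem, fun p hp t => ⟨_, isReebVector_reebField
    (hf.differentiable (by simp)) hpos (hmem p hp t), hγ p hp t⟩⟩, fun T hT => ?_⟩
  -- by uniqueness of integral curves, the flow preserves the equator
  have heq : ∀ t ∈ Icc 0 T, (γ (equator 0) t).1 = 0 ∧ (γ (equator 0) t).2 2 = 0 := by
    intro t ht
    have hN : 0 < T + 1 := by linarith
    have he : ∀ t, HasDerivAt (fun s => equator (s / (Real.pi * f 0)))
        (reebField f (equator (t / (Real.pi * f 0)))) t := by
      intro t
      rw [reebField_of_equatorial hpos hf0 (by simp [equator_eq]) (by simp [equator_eq])]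
      have hl : HasDerivAt (fun s => 2 * Real.pi * (s / (Real.pi * f 0))) (2 / f 0) t := by
        refine (((hasDerivAt_id t).div_const (Real.pi * f 0)).const_mul
          (2 * Real.pi)).congr_deriv ?_
        field_simp
      refine (((hasDerivAt_const t (0 : ℝ)).prodMk (hasDerivAt_vec3 hl.cos hl.sin
        (hasDerivAt_const t (0 : ℝ)))).congr_of_eventuallyEq
        (.of_forall fun s => equator_eq _)).congr_deriv ?_
      apply amb_ext <;> simp [equator_eq] <;> ring
    obtain ⟨K, hK⟩ := hV.contDiffOn.exists_lipschitzOnWith (by simp)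
      (convex_closedBall (0 : Amb) (|(equator 0).1| + (T + 1) / f 0 + 1)) (isCompact_closedBall _ _)
    have hen : ∀ t, ‖equator t‖ ≤ 1 := fun t => by
      have h1 : ‖(equator t).2‖ = 1 := by simpa [neck] using equator_mem_neck t
      rw [Prod.norm_def, h1, equator_eq]
      simp
    have hpos' := hpos 0
    have := ODE_solution_unique_of_mem_Ioo (v := fun _ => reebField f)
      (s := fun _ => closedBall (0 : Amb) (|(equator 0).1| + (T + 1) / f 0 + 1)) (t₀ := 0)
      (a := -(T + 1)) (b := T + 1) (f := γ (equator 0))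
      (g := fun s => equator (s / (Real.pi * f 0))) (fun _ _ => hK) (by constructor <;> linarith)
      (fun t ht => ⟨hγ _ (equator_mem_neck 0) t, mem_closedBall_zero_iff.2
        (hb _ (equator_mem_neck 0) _ hN t ht).2⟩)
      (fun t ht => ⟨he t, mem_closedBall_zero_iff.2 ((hen _).trans (by
        have : 0 ≤ |(equator 0).1| + (T + 1) / f 0 := by positivity
        linarith))⟩)
      (by simp [hγ0 _ (equator_mem_neck 0)])
      (show t ∈ Ioo (-(T + 1)) (T + 1) from ⟨by linarith [ht.1], by linarith [ht.2]⟩)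
    rw [this]
    simp [equator_eq]
  refine hasFDerivWithinAt_flow (ψ := fun t p => γ p t) (V := reebField f)
    (R := 1 + (T + 1) / f 0 + 1) (contDiff_infty.1 hV 2) (equator_mem_neck 0) hT ?_ hγ0
    (fun p hp t _ => hγ p hp t) (linFlow (f 0) κ) ?_ (fun h t ht => ?_)
  · have h1 : ∀ᶠ p : Amb in 𝓝 (equator 0), |p.1| < 1 :=
      (show Continuous fun p : Amb => |p.1| by fun_prop).continuousAt.eventually
        (gt_mem_nhds (show |(equator 0).1| < 1 by simp [equator_eq]))
    filter_upwards [h1.filter_mono nhdsWithin_le_nhds, self_mem_nhdsWithin] with p hp1 hp t ht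
    have := (hb p hp (T + 1) (by linarith) t ⟨by linarith [ht.1], by linarith [ht.2]⟩).2
    linarith
  · refine ContinuousLinearMap.ext fun h => ?_
    apply amb_ext <;> simp [linFlow_apply]
  · rw [fderiv_reebField_equatorial hf hpos hf0 (hmem _ (equator_mem_neck 0) t) (heq t ht).1
      (heq t ht).2]
    refine (hasDerivAt_linFlow hne hκ.ne' h t).congr_deriv ?_
    have : κ ^ 2 * f 0 = deriv (deriv f) 0 / (2 * f 0 ^ 2) := by
      rw [hκ2]; field_simp
    rw [this]

end Flow

/-! ### The Conley–Zehnder index of a hyperbolic path -/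

section ConleyZehnder

/-- The hyperbolic one-parameter group in `Sp(1)` generated by `[[0, -2/κ], [-κ/2, 0]]`. -/
noncomputable def hypMatrix (κ s : ℝ) : Matrix (Fin 2) (Fin 2) ℝ :=
  !![Real.cosh s, -(2 / κ) * Real.sinh s; -(κ / 2) * Real.sinh s, Real.cosh s]

theorem mem_Sp1_of_det {a b c d : ℝ} (h : a * d - b * c = 1) : !![a, b; c, d] ∈ Sp1 := by
  rw [Sp1, mem_ofPred_eq]
  ext i j
  fin_cases i <;> fin_cases j <;> simp [Matrix.mul_apply, Fin.sum_univ_two] <;> linarith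

/-- The hyperbolic group is joined to its inverse by turning its two eigenlines through a quarter of
a turn (with respect to a suitable inner product); this keeps the eigenvalues `e^{±τt}`. -/
noncomputable def hypHomotopy (κ τ s t : ℝ) : Matrix (Fin 2) (Fin 2) ℝ :=
  !![Real.cosh (τ * t) + Real.sinh (τ * t) * Real.sin (Real.pi * s),
      -(2 / κ) * (Real.sinh (τ * t) * Real.cos (Real.pi * s));
    -(κ / 2) * (Real.sinh (τ * t) * Real.cos (Real.pi * s)),
      Real.cosh (τ * t) - Real.sinh (τ * t) * Real.sin (Real.pi * s)]

theorem hypHomotopy_mem_Sp1 {κ : ℝ} (hκ : κ ≠ 0) (τ s t : ℝ) : hypHomotopy κ τ s t ∈ Sp1 := by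
  refine mem_Sp1_of_det ?_
  field_simp
  linear_combination Real.cosh_sq_sub_sinh_sq (τ * t)
    - Real.sinh (τ * t) ^ 2 * Real.sin_sq_add_cos_sq (Real.pi * s)

theorem hypHomotopy_zero_right (κ τ s : ℝ) : hypHomotopy κ τ s 0 = 1 := by
  ext i j
  fin_cases i <;> fin_cases j <;> simp [hypHomotopy]

theorem det_hypHomotopy_sub_one {κ τ : ℝ} (hκ : κ ≠ 0) (hτ : τ ≠ 0) (s : ℝ) :
    (hypHomotopy κ τ s 1 - 1).det ≠ 0 := by
  have h : (hypHomotopy κ τ s 1 - 1).det = 2 - 2 * Real.cosh τ := by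
    rw [Matrix.det_fin_two]
    simp [hypHomotopy]
    field_simp
    linear_combination Real.cosh_sq_sub_sinh_sq τ
      - Real.sinh τ ^ 2 * Real.sin_sq_add_cos_sq (Real.pi * s)
  rw [h]
  have := Real.one_lt_cosh.2 hτ
  linarith

theorem hypHomotopy_zero_left (κ τ t : ℝ) : hypHomotopy κ τ 0 t = hypMatrix κ (τ * t) := by
  simp [hypHomotopy, hypMatrix]

theorem hypHomotopy_one_left (κ τ t : ℝ) : hypHomotopy κ τ 1 t = hypMatrix κ (-(τ * t)) := by
  simp [hypHomotopy, hypMatrix]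

theorem continuous_hypHomotopy (κ τ : ℝ) :
    Continuous fun q : unitInterval × unitInterval => hypHomotopy κ τ q.1 q.2 := by
  refine continuous_matrix fun i j => ?_
  fin_cases i <;> fin_cases j <;> simp [hypHomotopy] <;> fun_prop

/-- The path `t ↦ exp (t τ [[0, -2/κ], [-κ/2, 0]])`, as an element of `Σ(1)`. -/
noncomputable def hypPath (κ τ : ℝ) (hκ : κ ≠ 0) (hτ : τ ≠ 0) : CZPath where
  path := ⟨fun t => hypMatrix κ (τ * t), by
    refine continuous_matrix fun i j => ?_
    fin_cases i <;> fin_cases j <;> simp [hypMatrix] <;> fun_prop⟩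
  mem t := by
    simpa [hypHomotopy_zero_left] using hypHomotopy_mem_Sp1 hκ τ 0 t
  source := by
    simpa [hypHomotopy_zero_left] using hypHomotopy_zero_right κ τ 0
  target := by
    simpa [hypHomotopy_zero_left] using det_hypHomotopy_sub_one hκ hτ 0

theorem hypPath_apply {κ τ : ℝ} (hκ : κ ≠ 0) (hτ : τ ≠ 0) (t : unitInterval) :
    (hypPath κ τ hκ hτ).path t = hypMatrix κ (τ * t) := rfl

theorem IsCZIndexMap.hypPath_eq_zero {μ : CZPath → ℤ} (hμ : IsCZIndexMap μ) {κ τ : ℝ}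
    (hκ : κ ≠ 0) (hτ : τ ≠ 0) : μ (hypPath κ τ hκ hτ) = 0 := by
  have h1 : μ (hypPath κ τ hκ hτ) = μ (hypPath κ (-τ) hκ (neg_ne_zero.2 hτ)) := by
    refine hμ.homotopy _ _ ⟨⟨_, continuous_hypHomotopy κ τ⟩, fun s t => ?_, fun s => ?_,
      fun s => ?_, fun t => ?_, fun t => ?_⟩
    · exact hypHomotopy_mem_Sp1 hκ τ s t
    · exact hypHomotopy_zero_right κ τ s
    · exact det_hypHomotopy_sub_one hκ hτ s
    · exact hypHomotopy_zero_left κ τ t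
    · exact (hypHomotopy_one_left κ τ t).trans (by rw [hypPath_apply, neg_mul])
  have h2 : μ (hypPath κ (-τ) hκ (neg_ne_zero.2 hτ)) = -μ (hypPath κ τ hκ hτ) := by
    refine hμ.inverse _ _ fun t => (Matrix.inv_eq_right_inv ?_).symm
    rw [hypPath_apply, hypPath_apply, neg_mul]
    have := Real.cosh_sq_sub_sinh_sq (τ * t)
    ext i j
    fin_cases i <;> fin_cases j <;>
      simp [hypMatrix, Matrix.mul_apply, Fin.sum_univ_two] <;> field_simp <;> linarith
  omega

theorem exists_polar {a b : ℝ} (h : a ≠ 0 ∨ b ≠ 0) :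
    ∃ r θ, 0 < r ∧ a = r * Real.cos θ ∧ b = r * Real.sin θ := by
  have hz : (⟨a, b⟩ : ℂ) ≠ 0 := by
    intro h0
    rw [Complex.ext_iff] at h0
    rcases h with h | h
    exacts [h h0.1, h h0.2]
  exact ⟨‖(⟨a, b⟩ : ℂ)‖, Complex.arg ⟨a, b⟩, norm_pos_iff.2 hz,
    (Complex.norm_mul_cos_arg ⟨a, b⟩).symm, (Complex.norm_mul_sin_arg ⟨a, b⟩).symm⟩

/-- The vector `(2, -κ)` is an eigenvector of all matrices of the path, so it does not turn. -/
theorem zero_mem_windingInterval {κ τ : ℝ} (hκ : κ ≠ 0) (hτ : τ ≠ 0) :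
    (0 : ℝ) ∈ windingInterval (hypPath κ τ hκ hτ) := by
  obtain ⟨r, θ, hr, h2, hk⟩ := exists_polar (a := 2) (b := -κ) (Or.inl two_ne_zero)
  refine ⟨![2, -κ], fun h => two_ne_zero (congrFun h 0), .const _ θ,
    fun t => r * Real.exp (τ * t), fun t => ⟨by positivity, ?_⟩, by simp⟩
  have e : (hypMatrix κ (τ * t)).mulVec ![2, -κ] = Real.exp (τ * t) • ![2, -κ] := by
    have hexp := Real.cosh_add_sinh (τ * t)
    ext i
    fin_cases i <;> simp [hypMatrix, Matrix.mulVec, dotProduct, Fin.sum_univ_two] <;>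
      field_simp <;> linarith
  rw [hypPath_apply, e]
  ext i
  fin_cases i
  · simp only [ContinuousMap.const_apply]
    simp
    linear_combination Real.exp (τ * t) * h2
  · simp only [ContinuousMap.const_apply]
    simp
    linear_combination Real.exp (τ * t) * hk

/-- No vector makes a nonzero whole number of turns: halfway it would point in the direction opposite
to the initial one, but the matrices of the path have no negative eigenvalue. -/
theorem eq_zero_of_mem_windingInterval {κ τ : ℝ} (hκ : κ ≠ 0) (hτ : τ ≠ 0) {k : ℤ}
    (hk : (k : ℝ) ∈ windingInterval (hypPath κ τ hκ hτ)) : k = 0 := by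
  obtain ⟨z, hz, θ, r, hr, hkθ⟩ := hk
  by_contra hk0
  have hpi := Real.pi_pos
  obtain ⟨t, ht⟩ : ∃ t, |θ t - θ 0| = Real.pi := by
    have hc : Continuous fun t => |θ t - θ 0| := by fun_prop
    refine mem_range_of_exists_le_of_exists_ge hc ⟨0, by simpa using hpi.le⟩ ⟨1, ?_⟩
    have h1 : (1 : ℝ) ≤ |(k : ℝ)| := by exact_mod_cast Int.one_le_abs hk0
    have h2 : θ 1 - θ 0 = k * (2 * Real.pi) := by rw [hkθ]; field_simp
    rw [h2, abs_mul, abs_of_pos (by positivity : (0 : ℝ) < 2 * Real.pi)]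
    nlinarith
  have hcs : Real.cos (θ t) = -Real.cos (θ 0) ∧ Real.sin (θ t) = -Real.sin (θ 0) := by
    rcases (abs_eq hpi.le).1 ht with h | h
    · rw [show θ t = θ 0 + Real.pi by linarith]
      exact ⟨Real.cos_add_pi _, Real.sin_add_pi _⟩
    · rw [show θ t = θ 0 - Real.pi by linarith]
      exact ⟨Real.cos_sub_pi _, Real.sin_sub_pi _⟩
  obtain ⟨hr0, h0⟩ := hr 0
  obtain ⟨hrt, ht⟩ := hr t
  rw [CZPath.source, Matrix.one_mulVec] at h0
  rw [hypPath_apply, hcs.1, hcs.2] at ht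
  have z0 := congrFun h0 0
  have z1 := congrFun h0 1
  have w0 := congrFun ht 0
  have w1 := congrFun ht 1
  simp [hypMatrix, Matrix.mulVec, dotProduct, Fin.sum_univ_two] at z0 z1 w0 w1
  set C := Real.cosh (τ * t)
  set S := Real.sinh (τ * t)
  have hC : 0 < C := Real.cosh_pos _
  have hCS : C ^ 2 - S ^ 2 = 1 := Real.cosh_sq_sub_sinh_sq _
  set q := r t / r 0 with hq
  have hq0 : 0 < q := div_pos hrt hr0
  have hrq : r t = q * r 0 := by rw [hq, div_mul_cancel₀ _ hr0.ne']
  have w0' : (C + q) * z 0 = 2 / κ * S * z 1 := by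
    rw [hrq] at w0
    linear_combination w0 + q * z0
  have w1' : (C + q) * z 1 = κ / 2 * S * z 0 := by
    rw [hrq] at w1
    linear_combination w1 + q * z1
  have hS : 2 / κ * S * (κ / 2 * S) = S ^ 2 := by field_simp
  -- `-q` would be an eigenvalue, but the matrix plus `q` has determinant `(C + q)² - S² > 0`
  have hpos : 0 < (C + q) ^ 2 - S ^ 2 := by nlinarith
  refine hz (funext fun i => ?_)
  have e0 : ((C + q) ^ 2 - S ^ 2) * z 0 = 0 := by
    linear_combination (C + q) * w0' + 2 / κ * S * w1' + z 0 * hS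
  have e1 : ((C + q) ^ 2 - S ^ 2) * z 1 = 0 := by
    linear_combination (C + q) * w1' + κ / 2 * S * w0' + z 1 * hS
  fin_cases i
  · exact (mul_eq_zero.1 e0).resolve_left hpos.ne'
  · exact (mul_eq_zero.1 e1).resolve_left hpos.ne'

theorem hasCZIndex_hypPath {κ τ : ℝ} (hκ : κ ≠ 0) (hτ : τ ≠ 0) (n : ℤ) :
    HasCZIndex (hypPath κ τ hκ hτ) n ↔ n = 0 := by
  have h0 := zero_mem_windingInterval hκ hτ
  constructor
  · rintro ⟨k, ⟨hn, hk⟩ | ⟨-, hk⟩⟩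
    · rw [hn, eq_zero_of_mem_windingInterval hκ hτ hk, mul_zero]
    · obtain ⟨h1, h2⟩ := hk h0
      have h1' : k < 0 := by exact_mod_cast h1
      have h2' : 0 < k + 1 := by exact_mod_cast h2
      omega
  · rintro rfl
    exact ⟨0, Or.inl ⟨rfl, by simpa using h0⟩⟩

end ConleyZehnder

/-! ### The frame along the equator and the return map -/

section ReturnMap

variable {f : ℝ → ℝ}

theorem equatorFrame_zero (f : ℝ → ℝ) (t : ℝ) : equatorFrame f 0 t = (1 / (2 * f 0), 0) := by
  simp [equatorFrame, frameOne, dRho_eq, Real.cot_eq_cos_div_sin]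

theorem equatorFrame_one (f : ℝ → ℝ) (t : ℝ) : equatorFrame f 1 t = (0, !₂[0, 0, -1]) := by
  simp [equatorFrame, frameTwo, dTheta_eq]

theorem isSymplecticFrame_equatorFrame (hf : Differentiable ℝ f) (hpos : ∀ ρ, 0 < f ρ) :
    IsSymplecticFrame (lambdaF f) equator (equatorFrame f) where
  smooth i := by
    fin_cases i
    · exact (funext (equatorFrame_zero f) : equatorFrame f 0 = _) ▸ contDiff_const
    · exact (funext (equatorFrame_one f) : equatorFrame f 1 = _) ▸ contDiff_const
  periodic i t := by
    fin_cases i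
    · exact (equatorFrame_zero f _).trans (equatorFrame_zero f _).symm
    · exact (equatorFrame_one f _).trans (equatorFrame_one f _).symm
  mem i t := by
    refine ⟨mem_tangentNeck_iff.2 ?_, LinearMap.mem_ker.2 ?_⟩
    · fin_cases i <;> simp [equatorFrame_zero, equatorFrame_one, equator_eq]
    · show lambdaF f _ _ = 0
      rw [lambdaF_apply, lambdaOne_apply]
      fin_cases i <;> simp [equatorFrame_zero, equatorFrame_one, equator_eq]
  symplectic t := by
    have := (hpos 0).ne'
    rw [formD_lambdaF hf, equatorFrame_zero, equatorFrame_one, lambdaOne_apply]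
    simp [equator_eq]
    field_simp

/-- The matrix of the linearized flow in the frame `v₁, v₂`. -/
theorem linFlow_equatorFrame {κ : ℝ} (hκ : κ ≠ 0) (hpos : ∀ ρ, 0 < f ρ) (s t : ℝ) (j : Fin 2) :
    linFlow (f 0) κ s (equatorFrame f j 0) =
      ∑ i, hypMatrix κ (κ * s) i j • equatorFrame f i t := by
  have := (hpos 0).ne'
  rw [Fin.sum_univ_two, equatorFrame_zero, equatorFrame_one, linFlow_apply]
  fin_cases j
  all_goals
    apply amb_ext <;> simp [equatorFrame_zero, equatorFrame_one, hypMatrix]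
    field_simp

theorem mem_contactPlane_equator_zero (hpos : ∀ ρ, 0 < f ρ) {w : Amb} :
    w ∈ contactPlane (lambdaF f) (equator 0) ↔ w.2 0 = 0 ∧ w.2 1 = 0 := by
  have := (hpos 0).ne'
  rw [contactPlane, Submodule.mem_inf, mem_tangentNeck_iff, LinearMap.mem_ker,
    ContinuousLinearMap.coe_coe, lambdaF_apply, lambdaOne_apply]
  simp [equator_eq, this]

/-- The basis of the contact plane at `equator 0` given by the frame `v₁, v₂`. -/
noncomputable def contactBasis (hpos : ∀ ρ, 0 < f ρ) :
    Module.Basis (Fin 2) ℝ (contactPlane (lambdaF f) (equator 0)) :=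
  .ofEquivFun
    { toFun := fun w => ![2 * f 0 * w.1.1, -w.1.2 2]
      map_add' := fun u w => by
        ext i
        fin_cases i <;> simp <;> ring
      map_smul' := fun c w => by
        ext i
        fin_cases i <;> simp
        ring
      invFun := fun c => ⟨(c 0 / (2 * f 0), !₂[0, 0, -c 1]), by
        rw [mem_contactPlane_equator_zero hpos]
        simp⟩
      left_inv := fun w => by
        have := (hpos 0).ne'
        obtain ⟨h0, h1⟩ := (mem_contactPlane_equator_zero hpos).1 w.2
        apply Subtype.ext
        apply amb_ext <;> simp [h0, h1]
        field_simp
      right_inv := fun c => by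
        have := (hpos 0).ne'
        ext i
        fin_cases i <;> simp
        field_simp }

theorem charpoly_hypMatrix {κ : ℝ} (hκ : κ ≠ 0) (s : ℝ) : (hypMatrix κ s).charpoly =
    (Polynomial.X - Polynomial.C (Real.exp s)) * (Polynomial.X - Polynomial.C (Real.exp (-s))) := by
  have htr : (hypMatrix κ s).trace = Real.exp s + Real.exp (-s) := by
    rw [Matrix.trace_fin_two, hypMatrix, Real.cosh_eq]
    simp
  have hdet : (hypMatrix κ s).det = Real.exp s * Real.exp (-s) := by
    rw [Matrix.det_fin_two, ← Real.exp_add, add_neg_cancel, Real.exp_zero]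
    simp [hypMatrix]
    field_simp
    linear_combination Real.cosh_sq_sub_sinh_sq s
  rw [Matrix.charpoly_fin_two, htr, hdet, map_add, map_mul]
  ring

/-- The return map of the equator exists and has the eigenvalues `e^{±κT}`. -/
theorem exists_isReturnMap (hpos : ∀ ρ, 0 < f ρ) {κ T : ℝ} (hκ : κ ≠ 0) {ψ : ℝ → Amb → Amb}
    (hψ : HasFDerivWithinAt (ψ T) (linFlow (f 0) κ T) neck (equator 0)) :
    ∃ A, IsReturnMap (lambdaF f) ψ T equator A ∧ A.charpoly.Splits ∧
      ∀ μ ∈ spectrum ℝ A, μ = Real.exp (κ * T) ∨ μ = Real.exp (-(κ * T)) := by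
  have hmap : ∀ w ∈ contactPlane (lambdaF f) (equator 0),
      (linFlow (f 0) κ T).toLinearMap w ∈ contactPlane (lambdaF f) (equator 0) := by
    intro w hw
    rw [mem_contactPlane_equator_zero hpos] at hw ⊢
    simp [linFlow_apply, hw.1, hw.2]
  let A : Module.End ℝ (contactPlane (lambdaF f) (equator 0)) :=
    (linFlow (f 0) κ T).toLinearMap.restrict hmap
  have hM : LinearMap.toMatrix (contactBasis hpos) (contactBasis hpos) A =
      hypMatrix κ (κ * T) := by
    have := (hpos 0).ne'
    ext i j
    rw [LinearMap.toMatrix_apply]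
    fin_cases i <;> fin_cases j <;>
      simp [contactBasis, A, LinearMap.restrict_apply, linFlow_apply, hypMatrix] <;> field_simp
  have hcp : A.charpoly = (Polynomial.X - Polynomial.C (Real.exp (κ * T))) *
      (Polynomial.X - Polynomial.C (Real.exp (-(κ * T)))) := by
    rw [← LinearMap.charpoly_toMatrix A (contactBasis hpos), hM, charpoly_hypMatrix hκ]
  have : FiniteDimensional ℝ (contactPlane (lambdaF f) (equator 0)) :=
    (contactBasis hpos).finiteDimensional_of_finite
  refine ⟨A, ⟨_, hψ, fun v => rfl⟩, ?_, fun μ hμ => ?_⟩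
  · rw [hcp]
    exact (Polynomial.Splits.X_sub_C _).mul (Polynomial.Splits.X_sub_C _)
  · rw [← Module.End.hasEigenvalue_iff_mem_spectrum, Module.End.hasEigenvalue_iff_isRoot_charpoly,
      hcp] at hμ
    simpa [sub_eq_zero] using hμ

end ReturnMap

/-! ### Dynamics of the Reeb flow of `f λ₁` -/

theorem lemma4p5 (f : ℝ → ℝ) (hf : ContDiff ℝ ∞ f) (hpos : ∀ ρ, 0 < f ρ)
    (hmono : ∀ ρ, ρ ≠ 0 → 0 < ρ * deriv f ρ) (hconv : 0 < deriv (deriv f) 0) :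
    -- the equator is a simple periodic Reeb orbit, and the only one up to reparametrization
    IsSimpleReebOrbit (lambdaF f) (Real.pi * f 0) equator ∧
    (∀ T γ, IsSimpleReebOrbit (lambdaF f) T γ →
      T = Real.pi * f 0 ∧ ∃ s, ∀ t, γ t = equator (t + s)) ∧
    -- `v₁, v₂` is a symplectic trivialization along it, with the stated values
    IsSymplecticFrame (lambdaF f) equator (equatorFrame f) ∧
    (∀ t, equatorFrame f 0 t = (1 / (2 * f 0)) • dRho 0 (Real.pi / 2) (2 * Real.pi * t) ∧
      equatorFrame f 1 t = dTheta 0 (Real.pi / 2) (2 * Real.pi * t)) ∧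
    -- with `ψ` the Reeb flow and `Ψ` the path of the linearized flow in this trivialization
    ∃ ψ, IsReebFlow (lambdaF f) ψ ∧
      IsHyperbolicOrbit (lambdaF f) ψ (Real.pi * f 0) equator ∧
      IsEvenOrbit (lambdaF f) ψ (Real.pi * f 0) equator ∧
      ∃ Ψ : CZPath,
        IsLinearizedFlowPath ψ (Real.pi * f 0) equator (equatorFrame f) Ψ ∧
        -- the Conley–Zehnder index is `0`, for the geometric definition and for
        -- any map satisfying the characterizing axioms
        (∀ n, HasCZIndex Ψ n ↔ n = 0) ∧
        (∀ μ, IsCZIndexMap μ → μ Ψ = 0) := by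
  have hdf : Differentiable ℝ f := hf.differentiable (by simp)
  have h0 := hpos 0
  have hf0 := deriv_zero_of_mul_deriv_pos hf hmono
  -- the rate for which `linFlow (f 0) κ` solves the linearized equation
  set κ := Real.sqrt (deriv (deriv f) 0 / (2 * f 0 ^ 3))
  have hκ : 0 < κ := Real.sqrt_pos.2 (by positivity)
  have hτ : 0 < κ * (Real.pi * f 0) := by positivity
  obtain ⟨ψ, hψ, hD⟩ := exists_reebFlow hf hpos hmono hκ (Real.sq_sqrt (by positivity))
  obtain ⟨A, hA, hsplit, hspec⟩ :=
    exists_isReturnMap hpos hκ.ne' (hD (Real.pi * f 0) (by positivity))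
  have hone : (1 : ℝ) ∉ spectrum ℝ A := fun h => by
    rcases hspec 1 h with h | h
    · exact hτ.ne' (Real.exp_eq_one_iff _ |>.1 h.symm)
    · exact (neg_lt_zero.2 hτ).ne (Real.exp_eq_one_iff _ |>.1 h.symm)
  refine ⟨isSimpleReebOrbit_equator hf hpos hf0, fun T γ hγ => hγ.eq_equator hf hpos hmono,
    isSymplecticFrame_equatorFrame hdf hpos, fun t => ⟨?_, ?_⟩, ψ, hψ, ⟨A, hA, hone, hsplit⟩,
    ⟨A, hA, hone, hsplit, fun μ hμ => ?_⟩, hypPath κ (κ * (Real.pi * f 0)) hκ.ne' hτ.ne',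
    fun t => ⟨_, hD _ (mul_nonneg t.2.1 (by positivity)), fun j => ?_⟩,
    hasCZIndex_hypPath _ _, fun μ hμ => hμ.hypPath_eq_zero _ _⟩
  · rw [equatorFrame_zero, dRho_eq]
    simp
  · rw [equatorFrame_one, dTheta_eq]
    simp
  · rcases hspec μ hμ with rfl | rfl <;> exact Real.exp_pos _
  · rw [linFlow_equatorFrame hκ.ne' hpos _ t, hypPath_apply,
      show κ * (t * (Real.pi * f 0)) = κ * (Real.pi * f 0) * t by ring]
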